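/- Let $G$ be a finitely generated (discrete) nilpotent group with center $Z(G)$, and let $\pi$ be a faithful (that is, injective on $G$) irreducible unitary representation of $G$ on a complex Hilbert space $H$. Let $C^*_\pi(G)\subseteq B(H)$ be the C*-algebra generated by $\pi(G)$. Then there are * a torsion-free subgroup $N\le Z(G)$ of finite index in $Z(G)$, * a 2-cocycle $\sigma$ on $G/N$, i.e. a function $\sigma:G/N\times G/N\to\mathbb{T}$ with $\sigma(x,y)\sigma(xy,z)=\sigma(x,yz)\sigma(y,z)$ and $\sigma(e,x)=\sigma(x,e)=1$ for all $x,y,z\in G/N$, and * a central projection $p\in C^*(G/N,\sigma)$, such that $C^*_\pi(G)\cong p\,C^*(G/N,\sigma)$ as C*-algebras. Here $C^*(G/N,\sigma)$ is the (full) twisted group C*-algebra, generated by the universal family of unitaries $(V_x)_{x\in G/N}$ with $V_xV_y=\sigma(x,y)V_{xy}$. Moreover, $\sigma$ is homotopic to the trivial cocycle: there are 2-cocycles $\Omega_t$ on $G/N$, $t\in[0,1]$, with $\Omega_0=\sigma$ and $\Omega_1=1$, such that $t\mapsto\Omega_t(x,y)$ is continuous for all $x,y\in G/N$. -/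

import Mathlib

open scoped ENNReal

noncomputable section

universe u v

/-! ### Unitary representations and the C*-algebras they generate -/

section UnitaryRepresentations

variable {G : Type u} [Group G] {H : Type v} [NormedAddCommGroup H] [InnerProductSpace ℂ H]
  [CompleteSpace H]

/-- A unitary representation on a Hilbert space is (topologically) irreducible if the space is
nonzero and has no closed invariant subspaces other than `0` and the whole space. -/
def IsIrreducibleRep (π : G →* unitary (H →L[ℂ] H)) : Prop :=
  Nontrivial H ∧
    ∀ K : Submodule ℂ H, IsClosed (K : Set H) →
      (∀ g : G, ∀ ξ ∈ K, (π g : H →L[ℂ] H) ξ ∈ K) → K = ⊥ ∨ K = ⊤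

/-- The C*-algebra `C*_π(G)` generated by `π(G)`: the norm closure of the *-algebra of operators
generated by the unitaries `π g`. -/
def repCStarAlgebra (π : G →* unitary (H →L[ℂ] H)) : StarSubalgebra ℂ (H →L[ℂ] H) :=
  (StarAlgebra.adjoin ℂ (Set.range fun g : G => (π g : H →L[ℂ] H))).topologicalClosure

end UnitaryRepresentations

/-! ### Circle-valued 2-cocycles and homotopy -/

/-- A (normalized) 2-cocycle on the discrete group `Γ` with values in the circle, the action of
`Γ` on the circle being trivial. -/
@[ext]
structure TwoCocycle (Γ : Type u) [Group Γ] where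
  toFun : Γ → Γ → Circle
  cocycle' : ∀ x y z : Γ, toFun x y * toFun (x * y) z = toFun x (y * z) * toFun y z
  one_left' : ∀ x : Γ, toFun 1 x = 1
  one_right' : ∀ x : Γ, toFun x 1 = 1

namespace TwoCocycle

variable {Γ : Type u} [Group Γ]

instance : CoeFun (TwoCocycle Γ) fun _ => Γ → Γ → Circle := ⟨TwoCocycle.toFun⟩

/-- The trivial cocycle. -/
def trivial (Γ : Type u) [Group Γ] : TwoCocycle Γ where
  toFun _ _ := 1
  cocycle' _ _ _ := rfl
  one_left' _ := rfl
  one_right' _ := rfl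

/-- Two cocycles on a discrete group are homotopic if they are joined by a path of cocycles
`t ↦ Ω t`, `t ∈ [0,1]`, which is continuous for pointwise convergence (equivalently, by a single
2-cocycle with values in the group `C([0,1], 𝕋)`). -/
def Homotopic (σ τ : TwoCocycle Γ) : Prop :=
  ∃ Ω : unitInterval → TwoCocycle Γ,
    (∀ x y : Γ, Continuous fun t => Ω t x y) ∧ Ω 0 = σ ∧ Ω 1 = τ

end TwoCocycle

/-! ### The (full) twisted group C*-algebra -/

/-- A `σ`-representation of `Γ`: unitaries `V x` on a nonzero complex Hilbert space with
`V x * V y = σ(x, y) V (x * y)`. -/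
structure TwistedRep {Γ : Type u} [Group Γ] (σ : TwoCocycle Γ) : Type (u + 1) where
  space : Type u
  [normed : NormedAddCommGroup space]
  [inner : InnerProductSpace ℂ space]
  [complete : CompleteSpace space]
  [nontriv : Nontrivial space]
  V : Γ → unitary (space →L[ℂ] space)
  map_mul' : ∀ x y : Γ, (V x : space →L[ℂ] space) * (V y : space →L[ℂ] space) =
    (σ x y : ℂ) • (V (x * y) : space →L[ℂ] space)

attribute [instance] TwistedRep.normed TwistedRep.inner TwistedRep.complete TwistedRep.nontriv

section TwistedGroupCStarAlgebra

variable {Γ : Type u} [Group Γ] (σ : TwoCocycle Γ)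

/-- The C*-algebra of bounded families of operators, indexed by all `σ`-representations of `Γ`
(on Hilbert spaces in the universe of `Γ`; up to unitary equivalence these include all cyclic
ones). -/
abbrev TwistedRepProduct : Type (u + 1) :=
  lp (fun ρ : TwistedRep σ => ρ.space →L[ℂ] ρ.space) ∞

/-- The canonical unitary of the universal `σ`-representation at `x`: the family `(ρ.V x)_ρ`. -/
def universalTwisted (x : Γ) : TwistedRepProduct σ :=
  ⟨fun ρ => (ρ.V x : ρ.space →L[ℂ] ρ.space), memℓp_infty ⟨1, by
    rintro _ ⟨ρ, rfl⟩
    exact (CStarRing.norm_coe_unitary (ρ.V x)).le⟩⟩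

/-- The (full) twisted group C*-algebra `C*(Γ, σ)`: the C*-algebra generated by the universal
`σ`-representation of `Γ`, that is, the completion of the twisted group algebra `ℂ[Γ, σ]` (or of
`ℓ¹(Γ, σ)`) in the norm `‖f‖ = sup_ρ ‖∑ₓ f(x) ρ(x)‖`, `ρ` running over the `σ`-representations. -/
def twistedGroupCStarAlgebra : StarSubalgebra ℂ (TwistedRepProduct σ) :=
  (StarAlgebra.adjoin ℂ (Set.range (universalTwisted σ))).topologicalClosure

/-- `C*(Γ, σ)` as a type, with the C*-algebra structure inherited from the product. -/
def TwistedGroupCStar : Type (u + 1) := twistedGroupCStarAlgebra σ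

instance : CStarAlgebra (TwistedRepProduct σ) where

instance : CStarAlgebra (TwistedGroupCStar σ) :=
  StarSubalgebra.cstarAlgebra (twistedGroupCStarAlgebra σ)
    (h_closed := StarSubalgebra.isClosed_topologicalClosure _)

end TwistedGroupCStarAlgebra

/-! ### Central cutdowns -/

/-- The cutdown `pA` of a C*-algebra `A` by a central projection `p`, with the operations inherited
from `A` (its unit is `p`). -/
def centralCutdown {A : Type v} [CStarAlgebra A] (p : A)
    (hp : IsStarProjection p) (hc : p ∈ Set.center A) : NonUnitalStarSubalgebra ℂ A where
  carrier := Set.range fun a : A => p * a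
  zero_mem' := ⟨0, mul_zero p⟩
  add_mem' := by
    rintro _ _ ⟨a, rfl⟩ ⟨b, rfl⟩
    exact ⟨a + b, mul_add p a b⟩
  mul_mem' := by
    rintro _ _ ⟨a, rfl⟩ ⟨b, rfl⟩
    exact ⟨a * (p * b), by simp only [mul_assoc]⟩
  smul_mem' := by
    rintro c _ ⟨a, rfl⟩
    exact ⟨c • a, mul_smul_comm c p a⟩
  star_mem' := by
    rintro _ ⟨a, rfl⟩
    refine ⟨star a, ?_⟩
    have h : p * star a = star a * p := (hc.comm (star a)).eq
    simp only [star_mul, hp.isSelfAdjoint.star_eq, h]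

end

/-! By Schur's lemma `π` is scalar on `Z(G)`, so on a torsion-free `N` of finite index in `Z(G)` it
is a character `χ`. Composing the `N`-valued cocycle of `N → G → G/N` with `χ` gives `σ`. Unitary
representations of `G` restricting to `χ` on `N` become `σ`-representations of `G/N`, so `π` induces
a *-homomorphism `E : C*(G/N, σ) → B(H)`, whose image turns out to be `C*_π(G)`. As `N` is free
abelian of finite rank, `χ = exp(iφ)` with `φ` real-valued and additive, and shrinking `φ` to zero
deforms `σ` to `1`.

The substance is that `ker E` is cut out by a central projection. Let `F` be the FC-centre of `G`
and `u` the canonical representation of `G` in `C*(G/N, σ)`. Since `Z(G)` has finite index in `F`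
(`finite_fcCenter_mod_center`), the span of `u(F)` is finite-dimensional. The kernel of `E` on it is
a finite-dimensional *-algebra, hence has a unit `q`; it is invariant under conjugation by `G`, so
`q` is central. Put `p = 1 - q`.

The estimate `‖p a‖ ≤ ‖E a‖` has three ingredients. On the span of `u(F)` it holds up to a constant
`C`, by finite dimension. On the span of `π(G)`, discarding the coefficients outside `F` is
contractive (`norm_sum_filter_fcCenter_le`): averages of conjugates over Følner sets of the
centralizer of `F` fix `π(F)` and send `π g` to zero in norm for `g` outside `F`. Applied coset by
coset, this gives `‖p a‖ ≤ |supp a| · C · ‖E a‖`. Finally, polynomial growth of `G` makes the factor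
subexponential along the powers `(a* a)^(2^k)`, so that it disappears on taking roots
(`norm_mul_le_of_bound`). -/

/-- The commutator `x⁻¹ s⁻¹ x s`, the correction term in `s⁻¹ x s = x * (x⁻¹ s⁻¹ x s)`. -/
def commutatorStep {G : Type*} [Group G] (s x : G) : G := x⁻¹ * s⁻¹ * x * s

/-! ### Elimination of generators by iterated commutators. -/

section CommutatorElimination

variable {G : Type*} [Group G]

lemma conj_eq_mul_commutatorStep (s x : G) : s⁻¹ * x * s = x * commutatorStep s x := by
  simp [commutatorStep, mul_assoc]

@[simp] lemma commutatorStep_one (s : G) : commutatorStep s 1 = 1 := by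
  simp [commutatorStep]

lemma commutatorStep_mem_upperCentralSeries {n : ℕ} (s : G) {x : G}
    (hx : x ∈ Subgroup.upperCentralSeries G (n + 1)) :
    commutatorStep s x ∈ Subgroup.upperCentralSeries G n := by
  simpa [commutatorElement_def, commutatorStep] using Subgroup.mem_upperCentralSeries_succ_iff.mp (inv_mem hx) s⁻¹

lemma commutatorStep_mem_of_mem {n : ℕ} (s : G) {x : G}
    (hx : x ∈ Subgroup.upperCentralSeries G n) :
    commutatorStep s x ∈ Subgroup.upperCentralSeries G n := by
  have h : commutatorStep s x = x⁻¹ * (s⁻¹ * x * s) := by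
    rw [conj_eq_mul_commutatorStep, inv_mul_cancel_left]
  rw [h]
  refine mul_mem (inv_mem hx) ?_
  simpa using Subgroup.Normal.conj_mem (inferInstance :
    (Subgroup.upperCentralSeries G n).Normal) x hx s⁻¹

lemma iterate_commutatorStep_mem {n : ℕ} (s : G) {x : G}
    (hx : x ∈ Subgroup.upperCentralSeries G n) (j : ℕ) :
    (commutatorStep s)^[j] x ∈ Subgroup.upperCentralSeries G n := by
  induction j with
  | zero => simpa
  | succ j ih =>
    rw [Function.iterate_succ_apply']
    exact commutatorStep_mem_of_mem s ih

lemma iterate_commutatorStep_mem_sub {n : ℕ} (s : G) (j : ℕ) {x : G}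
    (hx : x ∈ Subgroup.upperCentralSeries G (n + j)) :
    (commutatorStep s)^[j] x ∈ Subgroup.upperCentralSeries G n := by
  induction j generalizing x with
  | zero => simpa
  | succ j ih =>
    rw [Function.iterate_succ_apply]
    exact ih (commutatorStep_mem_upperCentralSeries s hx)

lemma iterate_commutatorStep_eq_one [Group.IsNilpotent G] (s x : G) :
    (commutatorStep s)^[Group.nilpotencyClass G] x = 1 := by
  have h : x ∈ Subgroup.upperCentralSeries G (0 + Group.nilpotencyClass G) := by
    rw [zero_add, Subgroup.upperCentralSeries_nilpotencyClass]; trivial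
  simpa using iterate_commutatorStep_mem_sub s _ h

open Classical in
/-- All iterated commutators of the elements of `R` by `s`. -/
noncomputable def commutatorLetters (s : G) (R : Finset G) : Finset G :=
  R.biUnion fun x =>
    (Finset.range (Group.nilpotencyClass G + 1)).image fun j => (commutatorStep s)^[j] x

lemma mem_commutatorLetters {s y : G} {R : Finset G} :
    y ∈ commutatorLetters s R ↔
      ∃ x ∈ R, ∃ j ≤ Group.nilpotencyClass G, (commutatorStep s)^[j] x = y := by
  simp [commutatorLetters]

open Classical in
/-- Induction over finite subsets of a nilpotent group by eliminating one element `s` at a time, at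
the cost of adding the iterated commutators by `s` of the remaining ones. -/
theorem finset_induction_commutatorLetters [Group.IsNilpotent G] {P : Finset G → Prop}
    (base : ∀ S : Finset G, (∀ x ∈ S, x = 1) → P S)
    (step : ∀ s R, P (commutatorLetters s R) → P (insert s R)) (S : Finset G) : P S := by
  suffices H : ∀ n, ∀ S : Finset G, (∀ x ∈ S, x ∈ Subgroup.upperCentralSeries G n) → P S by
    refine H (Group.nilpotencyClass G) S fun x _ => ?_
    rw [Subgroup.upperCentralSeries_nilpotencyClass]; trivial
  intro n
  induction n with
  | zero => intro S hS; exact base S (by simpa using hS)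
  | succ n ih =>
    intro S hS
    -- Inner induction on the number of elements of `S` lying outside the `n`-th term of the upper
    -- central series.
    suffices H : ∀ k, ∀ S : Finset G, (∀ x ∈ S, x ∈ Subgroup.upperCentralSeries G (n + 1)) →
        (S.filter fun x => x ∉ Subgroup.upperCentralSeries G n).card ≤ k → P S from
      H _ S hS le_rfl
    intro k
    induction k with
    | zero =>
      intro S hS hk
      refine ih S fun x hx => ?_
      by_contra hxn : x ∉ Subgroup.upperCentralSeries G n
      have := Finset.card_pos.mpr ⟨x, Finset.mem_filter (p := fun x => x ∉ Subgroup.upperCentralSeries G n) |>.mpr ⟨hx, hxn⟩⟩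
      omega
    | succ k ihk =>
      intro S hS hk
      by_cases hall : ∀ x ∈ S, x ∈ Subgroup.upperCentralSeries G n
      · exact ih S hall
      push Not at hall
      obtain ⟨s, hsS, hs⟩ := hall
      rw [← Finset.insert_erase hsS]
      refine step s _ (ihk _ ?_ ?_)
      · intro y hy
        obtain ⟨x, hx, j, -, rfl⟩ := mem_commutatorLetters.mp hy
        exact iterate_commutatorStep_mem s (hS x (Finset.mem_of_mem_erase hx)) j
      -- A proper iterated commutator drops into the `n`-th term, so the letters still outside it
      -- are among the old ones, and `s` is gone.
      · have hsub : ((commutatorLetters s (S.erase s)).filter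
            fun x => x ∉ Subgroup.upperCentralSeries G n) ⊆
            ((S.filter fun x => x ∉ Subgroup.upperCentralSeries G n).erase s) := by
          intro y hy
          obtain ⟨hy, hyn⟩ := Finset.mem_filter.mp hy
          obtain ⟨x, hx, j, -, rfl⟩ := mem_commutatorLetters.mp hy
          have hxS := Finset.mem_erase.mp hx
          rcases j with _ | j
          · simp only [Function.iterate_zero, id_eq] at hyn ⊢
            exact Finset.mem_erase.mpr ⟨hxS.1, Finset.mem_filter.mpr ⟨hxS.2, hyn⟩⟩
          · refine absurd ?_ hyn
            rw [Function.iterate_succ_apply']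
            exact commutatorStep_mem_upperCentralSeries s
              (iterate_commutatorStep_mem s (hS x hxS.2) j)
        have h1 := Finset.card_le_card hsub
        rw [Finset.card_erase_of_mem (Finset.mem_filter.mpr ⟨hsS, hs⟩)] at h1
        omega

end CommutatorElimination

/-! ### Polynomial growth of nilpotent groups. -/

section Growth

variable {G : Type*} [Group G]

/-- Write `x_j` for the `j`-th iterated commutator. From `s⁻¹ x_j s = x_j x_{j+1}`, the conjugate of
`x_j` by `s^(m+1)` is that of `x_j` by `s^m` times that of `x_{j+1}` by `s^m`. This Pascal-type
recursion stops once the commutators are trivial, so the length is polynomial in `m`. -/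
lemma exists_list_prod_eq_conj_pow (s x : G) (m k j : ℕ)
    (h : (commutatorStep s)^[j + k] x = 1) :
    ∃ l : List G, l.length ≤ (m + 1) ^ k ∧
      (∀ y ∈ l, ∃ i < j + k, (commutatorStep s)^[i] x = y) ∧
      l.prod = (s ^ m)⁻¹ * (commutatorStep s)^[j] x * s ^ m := by
  induction m generalizing k j with
  | zero =>
    rcases k with _ | k
    · exact ⟨[], by simp, by simp, by simpa using h.symm⟩
    · exact ⟨[(commutatorStep s)^[j] x], by simp, by
        simpa using ⟨j, by omega, rfl⟩, by simp⟩
  | succ m ih =>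
    rcases k with _ | k
    · refine ⟨[], by simp, by simp, ?_⟩
      rw [add_zero] at h
      simp [h]
    · obtain ⟨l₁, hl₁, hm₁, hp₁⟩ := ih (k + 1) j h
      obtain ⟨l₂, hl₂, hm₂, hp₂⟩ := ih k (j + 1) (by rwa [add_right_comm])
      refine ⟨l₁ ++ l₂, ?_, ?_, ?_⟩
      · rw [List.length_append]
        calc l₁.length + l₂.length ≤ (m + 1) ^ (k + 1) + (m + 1) ^ k := add_le_add hl₁ hl₂
          _ = (m + 1) ^ k * (m + 2) := by ring
          _ ≤ (m + 2) ^ k * (m + 2) := by gcongr; omega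
          _ = (m + 1 + 1) ^ (k + 1) := by ring
      · intro y hy
        rcases List.mem_append.mp hy with hy | hy
        · exact hm₁ y hy
        · obtain ⟨i, hi, rfl⟩ := hm₂ y hy
          exact ⟨i, by omega, rfl⟩
      · rw [List.prod_append, hp₁, hp₂, Function.iterate_succ_apply']
        have := conj_eq_mul_commutatorStep s ((commutatorStep s)^[j] x)
        rw [pow_succ' s m, mul_inv_rev]
        simp only [mul_assoc, mul_inv_cancel_left] at this ⊢
        rw [← mul_assoc _ (commutatorStep s _), ← mul_assoc ((commutatorStep s)^[j] x)]
        rw [← this]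
        simp [mul_assoc]

variable [Group.IsNilpotent G]

-- Collection process: every `s` is moved to the left, and each letter it crosses is replaced by its
-- conjugate by a power of `s`, rewritten as a short product of iterated commutators.
open Classical in
lemma exists_list_prod_eq_pow_mul (s : G) (R : Finset G) (n : ℕ) (l : List G)
    (hl : l.length ≤ n) (hmem : ∀ x ∈ l, x ∈ insert s R) :
    ∃ m ≤ l.length, ∃ l' : List G, l'.length ≤ l.length * (n + 1) ^ Group.nilpotencyClass G ∧
      (∀ x ∈ l', x ∈ commutatorLetters s R) ∧ l.prod = s ^ m * l'.prod := by
  induction l with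
  | nil => exact ⟨0, by simp, [], by simp, by simp, by simp⟩
  | cons x l ih =>
    rw [List.length_cons] at hl
    obtain ⟨m, hm, l', hl', hmem', hp⟩ := ih (by omega) fun y hy => hmem y (by simp [hy])
    rcases Finset.mem_insert.mp (hmem x (by simp)) with rfl | hx
    · refine ⟨m + 1, by simpa using hm, l', hl'.trans ?_, hmem', ?_⟩
      · rw [List.length_cons]; gcongr; omega
      · rw [List.prod_cons, hp, pow_succ', mul_assoc]
    · obtain ⟨l₁, hl₁, hm₁, hp₁⟩ := exists_list_prod_eq_conj_pow s x m (Group.nilpotencyClass G) 0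
        (by rw [zero_add]; exact iterate_commutatorStep_eq_one s x)
      refine ⟨m, by rw [List.length_cons]; omega, l₁ ++ l', ?_, ?_, ?_⟩
      · rw [List.length_append, List.length_cons, add_mul, one_mul, add_comm]
        refine add_le_add hl' (hl₁.trans ?_)
        gcongr; omega
      · intro y hy
        rcases List.mem_append.mp hy with hy | hy
        · obtain ⟨i, hi, rfl⟩ := hm₁ y hy
          exact mem_commutatorLetters.mpr ⟨x, hx, i, by omega, rfl⟩
        · exact hmem' y hy
      · rw [List.prod_cons, hp, List.prod_append, hp₁]
        simp [mul_assoc]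

/-- Finite subsets of nilpotent groups have polynomial growth. -/
theorem exists_polynomial_growth (S : Finset G) :
    ∃ C d : ℕ, ∀ n : ℕ, ∃ T : Finset G, T.card ≤ C * (n + 1) ^ d ∧
      ∀ l : List G, l.length ≤ n → (∀ x ∈ l, x ∈ S) → l.prod ∈ T := by
  classical
  induction S using finset_induction_commutatorLetters with
  | base S hS =>
    refine ⟨1, 0, fun n => ⟨{1}, by simp, fun l _ hl => ?_⟩⟩
    rw [Finset.mem_singleton]
    exact List.prod_eq_one fun x hx => hS x (hl x hx)
  | step s R ih =>
    obtain ⟨C, d, H⟩ := ih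
    set c := Group.nilpotencyClass G
    -- The factor `s^m` offers `n + 1` choices; the collected remainder is a word of length at most
    -- `n (n+1)^c`, whence the exponent `(c+1) d`.
    refine ⟨C, (c + 1) * d + 1, fun n => ?_⟩
    obtain ⟨T, hT, hmem⟩ := H (n * (n + 1) ^ c)
    refine ⟨(Finset.range (n + 1) ×ˢ T).image fun q => s ^ q.1 * q.2, ?_, ?_⟩
    · calc _ ≤ (Finset.range (n + 1) ×ˢ T).card := Finset.card_image_le
        _ = (n + 1) * T.card := by rw [Finset.card_product, Finset.card_range]
        _ ≤ (n + 1) * (C * (n * (n + 1) ^ c + 1) ^ d) := by gcongr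
        _ ≤ (n + 1) * (C * ((n + 1) ^ (c + 1)) ^ d) := by
          gcongr
          have : 1 ≤ (n + 1) ^ c := Nat.one_le_pow _ _ (by omega)
          rw [pow_succ]; nlinarith
        _ = C * (n + 1) ^ ((c + 1) * d + 1) := by rw [← pow_mul]; ring
    · intro l hl hlS
      obtain ⟨m, hm, l', hl', hmem', hp⟩ := exists_list_prod_eq_pow_mul s R n l hl hlS
      rw [hp]
      refine Finset.mem_image.mpr ⟨(m, l'.prod), Finset.mem_product.mpr
        ⟨Finset.mem_range.mpr (by omega), hmem l' (hl'.trans ?_) hmem'⟩, rfl⟩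
      gcongr

end Growth

/-! ### Subgroups of finitely generated nilpotent groups are finitely generated. -/

section Noetherian

variable {G : Type*} [Group G]

/-- If `s` normalizes `K` and all subgroups of `K` are finitely generated, then so are all
subgroups of `⟨s⟩K`. -/
lemma Subgroup.fg_of_le_normalizer {s : G} {K M : Subgroup G} (hs : s ∈ normalizer (K : Set G))
    (hK : ∀ L ≤ K, L.FG) (hM : ∀ x ∈ M, ∃ i : ℤ, s ^ i * x ∈ K) : M.FG := by
  have hconj : ∀ (i : ℤ) {x : G}, x ∈ K → s ^ i * x * (s ^ i)⁻¹ ∈ K := fun i x hx =>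
    (mem_normalizer_iff.mp (zpow_mem hs i) x).mp hx
  have hadd : ∀ {i j : ℤ} {x y : G}, s ^ i * x ∈ K → s ^ j * y ∈ K → s ^ (i + j) * (x * y) ∈ K := by
    intro i j x y hx hy
    have h := mul_mem (hconj j hx) hy
    rw [add_comm, zpow_add]
    simpa [mul_assoc] using h
  have hneg : ∀ {i : ℤ} {x : G}, s ^ i * x ∈ K → s ^ (-i) * x⁻¹ ∈ K := by
    intro i x hx
    have h := hconj (-i) (K.inv_mem hx)
    simpa [mul_assoc] using h
  -- The exponents of `s` that occur in `M` modulo `K` form a subgroup `dℤ`. An element `m`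
  -- realizing `d`, together with `M ⊓ K`, generates `M`.
  obtain ⟨I, hI⟩ : ∃ I : AddSubgroup ℤ, ∀ i, i ∈ I ↔ ∃ x ∈ M, s ^ i * x ∈ K := ⟨
    { carrier := {i | ∃ x ∈ M, s ^ i * x ∈ K}
      zero_mem' := ⟨1, one_mem _, by simp⟩
      add_mem' := by
        rintro i j ⟨x, hx, hxK⟩ ⟨y, hy, hyK⟩
        exact ⟨x * y, mul_mem hx hy, hadd hxK hyK⟩
      neg_mem' := by
        rintro i ⟨x, hx, hxK⟩
        exact ⟨x⁻¹, M.inv_mem hx, hneg hxK⟩ }, fun _ => Iff.rfl⟩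
  obtain ⟨d, hd⟩ := (Int.subgroup_cyclic I : ∃ d, I = AddSubgroup.closure {d})
  obtain ⟨m, hm, hmK⟩ := (hI d).mp (by rw [hd]; exact AddSubgroup.subset_closure (Set.mem_singleton d))
  have key : ∀ k : ℤ, s ^ (k • d) * m ^ k ∈ K := by
    intro k
    induction k with
    | zero => simp
    | succ k ih =>
      rw [add_smul, one_smul, zpow_add_one]
      exact hadd ih hmK
    | pred k ih =>
      rw [sub_smul, one_smul, sub_eq_add_neg, zpow_sub_one]
      exact hadd ih (hneg hmK)
  suffices M = closure {m} ⊔ (M ⊓ K) by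
    rw [this]
    exact FG.sup ⟨{m}, by simp⟩ (hK _ inf_le_right)
  refine le_antisymm (fun x hx => ?_) (sup_le (by simpa using hm) inf_le_left)
  obtain ⟨i, hi⟩ := hM x hx
  have hiI : i ∈ I := (hI i).mpr ⟨x, hx, hi⟩
  rw [hd, AddSubgroup.mem_closure_singleton] at hiI
  obtain ⟨k, rfl⟩ := hiI
  have h : (m ^ k)⁻¹ * x ∈ M ⊓ K := by
    refine ⟨M.mul_mem (M.inv_mem (M.zpow_mem hm k)) hx, ?_⟩
    simpa [mul_assoc] using K.mul_mem (K.inv_mem (key k)) hi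
  rw [show x = m ^ k * ((m ^ k)⁻¹ * x) by group]
  exact mul_mem (mem_sup_left (zpow_mem (subset_closure (Set.mem_singleton m)) k)) (mem_sup_right h)

variable [Group.IsNilpotent G]

/-- Conjugation by `s⁻¹` sends `x_j` to `x_j x_{j+1}`. Conjugation by `s` is solved from this
backwards, `s x_j s⁻¹ = x_j (s x_{j+1} s⁻¹)⁻¹`, starting where the commutators become trivial. -/
lemma mem_normalizer_closure_commutatorLetters (s : G) (R : Finset G) :
    s ∈ Subgroup.normalizer (Subgroup.closure (commutatorLetters s R : Set G) : Set G) := by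
  set K := Subgroup.closure (commutatorLetters s R : Set G)
  have hstep : ∀ x ∈ R, ∀ j, (commutatorStep s)^[j] x ∈ K := by
    intro x hx j
    rcases le_total j (Group.nilpotencyClass G) with h | h
    · exact Subgroup.subset_closure (mem_commutatorLetters.mpr ⟨x, hx, j, h, rfl⟩)
    · obtain ⟨k, rfl⟩ := Nat.exists_eq_add_of_le' h
      rw [Function.iterate_add_apply, iterate_commutatorStep_eq_one,
        Function.iterate_fixed (commutatorStep_one s)]
      exact one_mem _
  have hinv : ∀ x ∈ K, s⁻¹ * x * s ∈ K := by
    intro x hx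
    induction hx using Subgroup.closure_induction with
    | mem y hy =>
      obtain ⟨x, hx, j, -, rfl⟩ := mem_commutatorLetters.mp hy
      rw [conj_eq_mul_commutatorStep, ← Function.iterate_succ_apply' (commutatorStep s)]
      exact mul_mem (hstep x hx _) (hstep x hx _)
    | one => simp
    | mul a b _ _ ha hb => simpa [mul_assoc] using mul_mem ha hb
    | inv a _ ha => simpa [mul_assoc] using inv_mem ha
  have hpos : ∀ x ∈ K, s * x * s⁻¹ ∈ K := by
    intro x hx
    induction hx using Subgroup.closure_induction with
    | mem y hy =>
      obtain ⟨x, hx, j, -, rfl⟩ := mem_commutatorLetters.mp hy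
      -- Here `k` bounds the distance from `j` to the vanishing of the iterated commutators, so that
      -- induction on `k` descends in `j`.
      suffices H : ∀ k j, (commutatorStep s)^[j + k] x = 1 →
          s * (commutatorStep s)^[j] x * s⁻¹ ∈ K by
        refine H (Group.nilpotencyClass G) j ?_
        rw [Function.iterate_add_apply, iterate_commutatorStep_eq_one,
          Function.iterate_fixed (commutatorStep_one s)]
      intro k
      induction k with
      | zero => intro j hj; rw [add_zero] at hj; simp [hj]
      | succ k ih =>
        intro j hj
        have h := ih (j + 1) (by rwa [add_right_comm])
        rw [Function.iterate_succ_apply'] at h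
        have e := conj_eq_mul_commutatorStep s ((commutatorStep s)^[j] x)
        have e2 : s * (commutatorStep s)^[j] x * s⁻¹ = (commutatorStep s)^[j] x *
            (s * commutatorStep s ((commutatorStep s)^[j] x) * s⁻¹)⁻¹ := by
          rw [eq_mul_inv_iff_mul_eq]
          have e3 : s * ((commutatorStep s)^[j] x *
            commutatorStep s ((commutatorStep s)^[j] x)) * s⁻¹ = (commutatorStep s)^[j] x := by
            rw [← e]; group
          simpa [mul_assoc] using e3
        rw [e2]
        exact mul_mem (hstep x hx j) (inv_mem h)
    | one => simp
    | mul a b _ _ ha hb => simpa [mul_assoc] using mul_mem ha hb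
    | inv a _ ha => simpa [mul_assoc] using inv_mem ha
  rw [Subgroup.mem_normalizer_iff]
  refine fun x => ⟨hpos x, fun h => ?_⟩
  simpa [mul_assoc] using hinv _ h

/-- Subgroups of finitely generated nilpotent groups are finitely generated. -/
theorem Subgroup.fg_of_nilpotent [Group.FG G] (M : Subgroup G) : M.FG := by
  classical
  suffices H : ∀ S : Finset G, ∀ M ≤ closure (S : Set G), M.FG by
    obtain ⟨S, hS⟩ := (Group.fg_def.mp (inferInstance : Group.FG G))
    exact H S M (by rw [hS]; exact le_top)
  intro S
  induction S using finset_induction_commutatorLetters with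
  | base S hS =>
    intro M hM
    have : closure (S : Set G) = ⊥ := by
      rw [eq_bot_iff, closure_le]
      intro x hx
      simpa using hS x hx
    rw [this, le_bot_iff] at hM
    rw [hM]
    exact FG.bot
  | step s R ih =>
    intro M hM
    have hs := mem_normalizer_closure_commutatorLetters s R
    refine fg_of_le_normalizer hs ih fun x hx => ?_
    set K := closure (commutatorLetters s R : Set G)
    have hR : ∀ x ∈ R, x ∈ K := fun x hx =>
      subset_closure (mem_commutatorLetters.mpr ⟨x, hx, 0, by omega, rfl⟩)
    have hx' := hM hx
    clear hx
    induction hx' using closure_induction with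
    | mem y hy =>
      rcases Finset.mem_insert.mp (Finset.mem_coe.mp hy) with rfl | hy
      · exact ⟨-1, by simp⟩
      · exact ⟨0, by simpa using hR y hy⟩
    | one => exact ⟨0, by simp⟩
    | mul a b _ _ ha hb =>
      obtain ⟨i, hi⟩ := ha
      obtain ⟨j, hj⟩ := hb
      refine ⟨j + i, ?_⟩
      have h := (mem_normalizer_iff.mp (zpow_mem hs j) _).mp hi
      rw [zpow_add]
      simpa [mul_assoc] using mul_mem h hj
    | inv a _ ha =>
      obtain ⟨i, hi⟩ := ha
      refine ⟨-i, ?_⟩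
      have h := (mem_normalizer_iff.mp (zpow_mem hs (-i)) _).mp (inv_mem hi)
      simpa [mul_assoc] using h

end Noetherian

/-! ### The FC-centre and its index over the centre. -/

section FCCenter

/-- The FC-centre of a group: the elements with finitely many conjugates, that is, with a
centralizer of finite index. -/
def fcCenter (G : Type*) [Group G] : Subgroup G where
  carrier := {g | (Subgroup.centralizer {g}).FiniteIndex}
  one_mem' := by
    have : Subgroup.centralizer {(1 : G)} = ⊤ := by
      ext x; simp [Subgroup.mem_centralizer_singleton_iff]
    simp only [Set.mem_ofPred_eq, this]
    infer_instance
  mul_mem' := by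
    intro a b (ha : (Subgroup.centralizer {a}).FiniteIndex)
      (hb : (Subgroup.centralizer {b}).FiniteIndex)
    refine Subgroup.finiteIndex_of_le (H := Subgroup.centralizer {a} ⊓ Subgroup.centralizer {b}) ?_
    rintro x ⟨hxa, hxb⟩
    replace hxa := Subgroup.mem_centralizer_singleton_iff.mp hxa
    replace hxb := Subgroup.mem_centralizer_singleton_iff.mp hxb
    rw [Subgroup.mem_centralizer_singleton_iff, ← mul_assoc, hxa, mul_assoc, hxb, mul_assoc]
  inv_mem' := by
    intro a (ha : (Subgroup.centralizer {a}).FiniteIndex)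
    refine Subgroup.finiteIndex_of_le (H := Subgroup.centralizer {a}) ?_
    intro x hx
    rw [Subgroup.mem_centralizer_singleton_iff] at hx ⊢
    exact (Commute.inv_right (show Commute x a from hx)).eq

variable {G : Type*} [Group G]

lemma mem_fcCenter {g : G} : g ∈ fcCenter G ↔ (Subgroup.centralizer {g}).FiniteIndex := Iff.rfl

lemma center_le_fcCenter : Subgroup.center G ≤ fcCenter G := by
  intro z hz
  have : Subgroup.centralizer {z} = ⊤ := by
    ext x
    simpa [Subgroup.mem_centralizer_singleton_iff] using Subgroup.mem_center_iff.mp hz x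
  rw [mem_fcCenter, this]
  infer_instance

instance : (fcCenter G).Normal where
  conj_mem g hg x := by
    rw [mem_fcCenter] at hg ⊢
    have : Subgroup.centralizer {x * g * x⁻¹} =
        (Subgroup.centralizer {g}).comap (MulAut.conj x⁻¹).toMonoidHom := by
      ext y
      simp only [Subgroup.mem_centralizer_singleton_iff, Subgroup.mem_comap,
        MulEquiv.coe_toMonoidHom, MulAut.conj_apply, inv_inv]
      constructor <;> intro h
      · calc x⁻¹ * y * x * g = x⁻¹ * (y * (x * g * x⁻¹)) * x := by group
          _ = _ := by rw [h]; group
      · calc y * (x * g * x⁻¹) = x * (x⁻¹ * y * x * g) * x⁻¹ := by group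
          _ = _ := by rw [h]; group
    refine ⟨?_⟩
    rw [this, Subgroup.index_comap_of_surjective _ (MulAut.conj x⁻¹).surjective]
    exact hg.index_ne_zero

lemma exists_pow_commute_of_mem_fcCenter {f : G} (hf : f ∈ fcCenter G) (s : G) :
    ∃ k : ℕ, 0 < k ∧ Commute (s ^ k) f := by
  obtain ⟨k, hk, -, h⟩ := Subgroup.exists_pow_mem_of_index_ne_zero
    (mem_fcCenter.mp hf).index_ne_zero s
  exact ⟨k, hk, Subgroup.mem_centralizer_singleton_iff.mp h⟩

lemma Set.Finite.image_of_factors {α β γ : Type*} {X : Set α} {Φ : α → β} {q : α → γ}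
    (hfin : (Φ '' X).Finite) (h : ∀ a ∈ X, ∀ b ∈ X, Φ a = Φ b → q a = q b) : (q '' X).Finite := by
  classical
  rcases X.eq_empty_or_nonempty with rfl | ⟨x, hx⟩
  · simp
  have : Nonempty α := ⟨x⟩
  refine (hfin.image fun y => q (Function.invFunOn Φ X y)).subset ?_
  rintro _ ⟨a, ha, rfl⟩
  have hex : ∃ b ∈ X, Φ b = Φ a := ⟨a, ha, rfl⟩
  exact ⟨Φ a, ⟨a, ha, rfl⟩, h _ (Function.invFunOn_mem hex) _ ha (Function.invFunOn_eq hex)⟩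

/-- If `f, f'` have centralizers of finite index and `⁅f', s⁆ = z ⁅f, s⁆` with `z` central, then
`z` is torsion. -/
lemma isOfFinOrder_of_conj_eq {f f' s z : G} (hf : f ∈ fcCenter G) (hf' : f' ∈ fcCenter G)
    (hz : z ∈ Subgroup.center G) (h : f' * s * f'⁻¹ = z * (f * s * f⁻¹)) : IsOfFinOrder z := by
  -- A power of `s` commutes with `f` and with `f'`, so both conjugates of `s` have the same `k
  -- k'`-th power, which forces `z ^ (k k') = 1`.
  obtain ⟨k, hk, hc⟩ := exists_pow_commute_of_mem_fcCenter hf s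
  obtain ⟨k', hk', hc'⟩ := exists_pow_commute_of_mem_fcCenter hf' s
  refine isOfFinOrder_iff_pow_eq_one.mpr ⟨k * k', Nat.mul_pos hk hk', ?_⟩
  have h1 : (f * s * f⁻¹) ^ (k * k') = s ^ (k * k') := by
    rw [conj_pow, pow_mul, ← (hc.pow_left k').eq, mul_inv_cancel_right]
  have h2 : (f' * s * f'⁻¹) ^ (k * k') = s ^ (k * k') := by
    rw [conj_pow, mul_comm k, pow_mul, ← (hc'.pow_left k).eq, mul_inv_cancel_right]
  have hzc : Commute z (f * s * f⁻¹) := (Subgroup.mem_center_iff.mp hz _).symm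
  rw [h, hzc.mul_pow, h1] at h2
  exact mul_eq_right.mp h2

section FiniteGeneration

variable [Group.FG G] [Group.IsNilpotent G]

instance : Group.FG (Subgroup.center G) :=
  (Group.fg_iff_subgroup_fg _).mpr (Subgroup.fg_of_nilpotent _)

open scoped IsMulCommutative in
variable (G) in
lemma finite_torsion_center : {z : G | z ∈ Subgroup.center G ∧ IsOfFinOrder z}.Finite := by
  have hfg : Group.FG (CommGroup.torsion (Subgroup.center G)) :=
    Group.fg_iff_subgroup_fg _ |>.mpr (Subgroup.fg_of_nilpotent _)
  have : Finite (CommGroup.torsion (Subgroup.center G)) :=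
    CommGroup.finite_of_fg_isMulTorsion _ (CommMonoid.torsion.isMulTorsion)
  refine (Set.finite_range fun z : CommGroup.torsion (Subgroup.center G) =>
    ((z : Subgroup.center G) : G)).subset ?_
  rintro z ⟨hz, ho⟩
  exact ⟨⟨⟨z, hz⟩, Submonoid.isOfFinOrder_coe.mp ho⟩, rfl⟩

/-- The commutator of `f` with `s` lies in the FC-centre one level lower, where only finitely many
classes modulo the centre occur. Within one class, two conjugates of `s` differ by a central element
that must be torsion, and the centre has finite torsion. -/
lemma finite_conj_fcCenter (n : ℕ)
    (hn : ((QuotientGroup.mk : G → G ⧸ Subgroup.center G) ''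
      {f | f ∈ fcCenter G ∧ f ∈ Subgroup.upperCentralSeries G n}).Finite) (s : G) :
    ((fun f => f * s * f⁻¹) ''
      {f | f ∈ fcCenter G ∧ f ∈ Subgroup.upperCentralSeries G (n + 1)}).Finite := by
  set X := {f | f ∈ fcCenter G ∧ f ∈ Subgroup.upperCentralSeries G (n + 1)}
  have hfin : ((fun f => (QuotientGroup.mk (f * s * f⁻¹ * s⁻¹) : G ⧸ Subgroup.center G)) ''
      X).Finite := by
    refine hn.subset ?_
    rintro _ ⟨f, ⟨hf, hfn⟩, rfl⟩
    refine ⟨_, ⟨?_, Subgroup.mem_upperCentralSeries_succ_iff.mp hfn s⟩, rfl⟩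
    rw [commutatorElement_def, mul_assoc, mul_assoc]
    refine mul_mem hf ?_
    rw [← mul_assoc]
    exact Subgroup.Normal.conj_mem inferInstance _ (inv_mem hf) s
  obtain ⟨X₀, hX₀, hbij⟩ := Set.SurjOn.exists_bijOn_subset
    (Set.surjOn_image (fun f => (QuotientGroup.mk (f * s * f⁻¹ * s⁻¹) : G ⧸ Subgroup.center G)) X)
  have hX₀fin : X₀.Finite := hbij.finite_iff_finite.mpr hfin
  refine (((finite_torsion_center G).prod hX₀fin).image
    fun p => p.1 * (p.2 * s * p.2⁻¹)).subset ?_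
  rintro _ ⟨f, hf, rfl⟩
  obtain ⟨f₀, hf₀, he⟩ := hbij.surjOn ⟨f, hf, rfl⟩
  have hz := QuotientGroup.eq.mp he
  have he' : f * s * f⁻¹ = (f₀ * s * f₀⁻¹ * s⁻¹)⁻¹ * (f * s * f⁻¹ * s⁻¹) * (f₀ * s * f₀⁻¹) := by
    have hc := Subgroup.mem_center_iff.mp hz (f₀ * s * f₀⁻¹)
    have hs := Subgroup.mem_center_iff.mp hz s
    rw [← hc]
    calc f * s * f⁻¹ = f₀ * s * f₀⁻¹ * s⁻¹ * ((f₀ * s * f₀⁻¹ * s⁻¹)⁻¹ * (f * s * f⁻¹ * s⁻¹)) * s := by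
          simp [mul_assoc]
      _ = _ := by rw [mul_assoc _ _ s, ← hs]; simp [mul_assoc]
  exact ⟨((f₀ * s * f₀⁻¹ * s⁻¹)⁻¹ * (f * s * f⁻¹ * s⁻¹), f₀),
    ⟨⟨hz, isOfFinOrder_of_conj_eq (hX₀ hf₀).1 hf.1 hz he'⟩, hf₀⟩, he'.symm⟩

variable (G) in
/-- In a finitely generated nilpotent group the centre has finite index in the FC-centre. -/
theorem finite_fcCenter_mod_center :
    ((QuotientGroup.mk : G → G ⧸ Subgroup.center G) '' (fcCenter G : Set G)).Finite := by
  classical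
  suffices H : ∀ n, ((QuotientGroup.mk : G → G ⧸ Subgroup.center G) ''
      {f | f ∈ fcCenter G ∧ f ∈ Subgroup.upperCentralSeries G n}).Finite by
    obtain ⟨n, hn⟩ := Group.IsNilpotent.nilpotent G
    simpa [hn] using H n
  intro n
  induction n with
  | zero =>
    refine (Set.finite_singleton (QuotientGroup.mk 1)).subset ?_
    rintro _ ⟨f, ⟨-, hf⟩, rfl⟩
    have : f = 1 := by simpa using hf
    simp [this]
  | succ n ih =>
    obtain ⟨S, hS⟩ := Group.fg_def.mp (inferInstance : Group.FG G)
    -- Modulo the centre, `f` is determined by its conjugates of a finite generating set.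
    refine Set.Finite.image_of_factors (Φ := fun (f : G) (s : S) => f * (s : G) * f⁻¹) ?_ ?_
    · refine (Set.Finite.pi fun s : S => finite_conj_fcCenter n ih (s : G)).subset ?_
      rintro _ ⟨f, hf, rfl⟩ s -
      exact ⟨f, hf, rfl⟩
    · intro f _ f' _ h
      refine QuotientGroup.eq.mpr ?_
      have hle : Subgroup.closure (S : Set G) ≤ Subgroup.centralizer {f⁻¹ * f'} := by
        rw [Subgroup.closure_le]
        intro s hs
        have h1 : f * s * f⁻¹ = f' * s * f'⁻¹ := congrFun h ⟨s, hs⟩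
        rw [SetLike.mem_coe, Subgroup.mem_centralizer_singleton_iff]
        calc s * (f⁻¹ * f') = f⁻¹ * (f * s * f⁻¹) * f' := by group
          _ = _ := by rw [h1]; group
      rw [hS] at hle
      exact Subgroup.mem_center_iff.mpr fun x =>
        Subgroup.mem_centralizer_singleton_iff.mp (hle (Subgroup.mem_top x))

/-- Central factors do not affect centralizers, so it suffices to intersect the centralizers of
finitely many representatives of the FC-centre modulo the centre. -/
instance finiteIndex_centralizer_fcCenter :
    (Subgroup.centralizer (fcCenter G : Set G)).FiniteIndex := by
  obtain ⟨X₀, hX₀, hbij⟩ := Set.SurjOn.exists_bijOn_subset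
    (Set.surjOn_image (QuotientGroup.mk : G → G ⧸ Subgroup.center G) (fcCenter G : Set G))
  have hX₀fin : Finite X₀ :=
    (hbij.finite_iff_finite.mpr (finite_fcCenter_mod_center G)).to_subtype
  have : (⨅ x : X₀, Subgroup.centralizer {(x : G)}).FiniteIndex :=
    Subgroup.finiteIndex_iInf fun x => mem_fcCenter.mp (hX₀ x.2)
  refine Subgroup.finiteIndex_of_le (H := ⨅ x : X₀, Subgroup.centralizer {(x : G)}) ?_
  intro y hy
  rw [Subgroup.mem_centralizer_iff]
  intro f hf
  obtain ⟨f₀, hf₀, he⟩ := hbij.surjOn ⟨f, hf, rfl⟩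
  have hz := QuotientGroup.eq.mp he
  have hyf := Subgroup.mem_centralizer_singleton_iff.mp (Subgroup.mem_iInf.mp hy ⟨f₀, hf₀⟩)
  have hzy := Subgroup.mem_center_iff.mp hz y
  calc f * y = f₀ * (f₀⁻¹ * f * y) := by group
    _ = f₀ * y * (f₀⁻¹ * f) := by rw [← hzy, mul_assoc]
    _ = y * f := by rw [← hyf]; group

open scoped IsMulCommutative in
variable (G) in
/-- The centre of a finitely generated nilpotent group has a torsion-free subgroup of finite
index. -/
theorem exists_torsionFree_finiteRelIndex_center :
    ∃ N ≤ Subgroup.center G, N.IsFiniteRelIndex (Subgroup.center G) ∧ IsMulTorsionFree N := by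
  classical
  have hfin := finite_torsion_center G
  -- Raising to the power `t` kills the torsion of the centre. Hence the `t`-th powers form a
  -- torsion-free subgroup: if `z ^ t` is torsion then so is `z`, and `z ^ t = 1`.
  let t := ∏ z ∈ hfin.toFinset, orderOf z
  have ht : t ≠ 0 := Finset.prod_ne_zero_iff.mpr fun z hz =>
    ((hfin.mem_toFinset.mp hz).2.orderOf_pos).ne'
  have htor : ∀ z ∈ Subgroup.center G, IsOfFinOrder z → z ^ t = 1 := fun z hz ho =>
    orderOf_dvd_iff_pow_eq_one.mp
      (Finset.dvd_prod_of_mem _ (hfin.mem_toFinset.mpr ⟨hz, ho⟩))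
  let P := (powMonoidHom (α := Subgroup.center G) t).range
  have hP : P.FiniteIndex := Subgroup.finiteIndex_range_powMonoidHom_of_fg _ ht
  refine ⟨P.map (Subgroup.center G).subtype, Subgroup.map_subtype_le P, ?_, ?_⟩
  · rw [Subgroup.isFiniteRelIndex_iff_finiteIndex, ← Subgroup.comap_subtype,
      Subgroup.comap_map_eq_self_of_injective Subtype.val_injective]
    exact hP
  · have hone : ∀ z ∈ P.map (Subgroup.center G).subtype, ∀ n : ℕ, n ≠ 0 → z ^ n = 1 → z = 1 := by
      rintro _ ⟨_, ⟨z, rfl⟩, rfl⟩ n hn h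
      have h' : (z : G) ^ (t * n) = 1 := by simpa [pow_mul] using h
      simpa using htor z z.2 (isOfFinOrder_iff_pow_eq_one.mpr
        ⟨t * n, Nat.pos_of_ne_zero (mul_ne_zero ht hn), h'⟩)
    refine ⟨fun n hn a b hab => ?_⟩
    have hcomm : Commute (a : G) b⁻¹ :=
      (Subgroup.mem_center_iff.mp (Subgroup.map_subtype_le P a.2) _).symm
    have h : ((a : G) * (b : G)⁻¹) ^ n = 1 := by
      rw [hcomm.mul_pow, inv_pow, mul_inv_eq_one]
      exact congrArg Subtype.val hab
    exact Subtype.ext (mul_inv_eq_one.mp (hone _ (mul_mem a.2 (inv_mem b.2)) n hn h))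

end FiniteGeneration

end FCCenter

/-! ### Lifting characters to the real line. -/

section CircleLift

/-- Characters of finitely generated torsion-free abelian groups lift along `ℝ → 𝕋`. -/
theorem exists_circleExp_lift {N : Type*} [CommGroup N] [Group.FG N] [IsMulTorsionFree N]
    (χ : N →* Circle) : ∃ φ : Additive N →+ ℝ, ∀ n : N, Circle.exp (φ (Additive.ofMul n)) = χ n := by
  have : Module.Finite ℤ (Additive N) := Module.Finite.iff_addGroup_fg.mpr inferInstance
  have : Module.Free ℤ (Additive N) := inferInstance
  let b := Module.Free.chooseBasis ℤ (Additive N)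
  let φ : Additive N →ₗ[ℤ] ℝ := b.constr ℤ fun i => Complex.arg (χ (b i).toMul)
  refine ⟨φ.toAddMonoidHom, fun n => ?_⟩
  let f : Additive N →+ Additive Circle := Circle.expHom.comp φ.toAddMonoidHom
  let g : Additive N →+ Additive Circle := MonoidHom.toAdditive χ
  have hfg : f.toIntLinearMap = g.toIntLinearMap := by
    refine b.ext fun i => ?_
    change Additive.ofMul (Circle.exp (φ (b i))) = Additive.ofMul (χ (b i).toMul)
    rw [Module.Basis.constr_basis, Circle.exp_arg]
  exact congrArg Additive.toMul (LinearMap.congr_fun hfg (Additive.ofMul n))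

end CircleLift

/-! ### Følner sets from polynomial growth. -/

section Folner

open Filter Topology Pointwise

variable (G : Type*) [Group G] [Group.FG G] [Group.IsNilpotent G]

open Classical in
/-- Finitely generated nilpotent groups have Følner sequences. -/
theorem exists_folner_sequence : ∃ B : ℕ → Finset G, (∀ n, (B n).Nonempty) ∧
    ∃ S : Set G, Subgroup.closure S = ⊤ ∧ ∀ s ∈ S, Tendsto
      (fun n => (((B n).image (· * s) \ B n).card : ℝ) / (B n).card) atTop (𝓝 0) := by
  obtain ⟨S, hS⟩ := Group.fg_def.mp (inferInstance : Group.FG G)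
  obtain ⟨C, d, hgrowth⟩ := exists_polynomial_growth S
  set S' : Finset G := insert 1 S
  let W : ℕ → Finset G := fun n => S' ^ n
  have hW1 : ∀ n, (1 : G) ∈ W n := fun n => Finset.one_mem_pow (Finset.mem_insert_self _ _)
  have hWpos : ∀ n, 0 < ((W n).card : ℝ) := fun n =>
    Nat.cast_pos.mpr (Finset.card_pos.mpr ⟨1, hW1 n⟩)
  have hWmono : ∀ n, W n ⊆ W (n + 1) := fun n =>
    Finset.pow_subset_pow_right (Finset.mem_insert_self _ _) (Nat.le_succ n)
  have hcard : ∀ n, ((W n).card : ℝ) ≤ C * (n + 1) ^ d := by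
    intro n
    obtain ⟨T, hT, hmem⟩ := hgrowth n
    have hsub : W n ⊆ T := by
      suffices H : ∀ n, ∀ x ∈ W n, ∃ l : List G, l.length ≤ n ∧ (∀ y ∈ l, y ∈ S) ∧ l.prod = x by
        intro x hx
        obtain ⟨l, hl, hlS, rfl⟩ := H n x hx
        exact hmem l hl hlS
      intro n
      induction n with
      | zero => intro x hx; exact ⟨[], by simp, by simp, by simpa [W, eq_comm] using hx⟩
      | succ n ih =>
        intro x hx
        rw [show W (n + 1) = S' * S' ^ n from pow_succ' S' n, Finset.mem_mul] at hx
        obtain ⟨s, hs, y, hy, rfl⟩ := hx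
        obtain ⟨l, hl, hlS, rfl⟩ := ih y hy
        rcases Finset.mem_insert.mp hs with rfl | hs
        · exact ⟨l, by omega, hlS, by simp⟩
        · refine ⟨s :: l, by simpa using hl, ?_, by simp⟩
          intro y hy
          rcases List.mem_cons.mp hy with rfl | hy
          · exact hs
          · exact hlS y hy
    calc ((W n).card : ℝ) ≤ T.card := by exact_mod_cast Finset.card_le_card hsub
      _ ≤ C * (n + 1) ^ d := by exact_mod_cast hT
  -- If every ratio of successive balls exceeded `1 + ε`, the balls would grow exponentially.
  have hratio : ∀ ε : ℝ, 0 < ε → ∃ n, ((W (n + 1)).card : ℝ) ≤ (1 + ε) * (W n).card := by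
    intro ε hε
    by_contra! hcon
    have hexp : ∀ n, (1 + ε) ^ n ≤ ((W n).card : ℝ) := by
      intro n
      induction n with
      | zero => simp [W]
      | succ n ih =>
        rw [pow_succ']
        exact (mul_le_mul_of_nonneg_left ih (by positivity)).trans (hcon n).le
    have hlim : Tendsto (fun n : ℕ => (C : ℝ) * ((n : ℝ) + 1) ^ d * ((1 + ε)⁻¹) ^ n) atTop (𝓝 0) := by
      have h1 := tendsto_pow_const_mul_const_pow_of_abs_lt_one d (r := (1 + ε)⁻¹) (by
        rw [abs_of_pos (by positivity)]; exact inv_lt_one_of_one_lt₀ (by linarith))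
      have h2 := ((tendsto_add_atTop_iff_nat 1).mpr h1).const_mul ((C : ℝ) * (1 + ε))
      rw [mul_zero] at h2
      refine h2.congr fun n => ?_
      have h3 : (1 + ε) * (1 + ε)⁻¹ = 1 := mul_inv_cancel₀ (by positivity)
      push_cast
      linear_combination (C * ((n : ℝ) + 1) ^ d * (1 + ε)⁻¹ ^ n) * h3
    obtain ⟨n, hn⟩ := (hlim.eventually (gt_mem_nhds one_pos)).exists
    have h3 := (hexp n).trans (hcard n)
    rw [inv_pow, ← div_eq_mul_inv, div_lt_one (by positivity)] at hn
    linarith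
  choose N hN using fun j : ℕ => hratio (1 / ((j : ℝ) + 1)) Nat.one_div_pos_of_nat
  refine ⟨fun j => W (N j), fun j => ⟨1, hW1 _⟩, S, hS, fun s hs => ?_⟩
  refine squeeze_zero (fun j => by positivity) (fun j => ?_) tendsto_one_div_add_atTop_nhds_zero_nat
  rw [div_le_iff₀ (hWpos _)]
  -- Right translation by a generator stays in the next ball, so the boundary is counted by the
  -- increment of the ball sizes.
  have hsub : (W (N j)).image (· * s) \ W (N j) ⊆ W (N j + 1) \ W (N j) := by
    refine Finset.sdiff_subset_sdiff ?_ subset_rfl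
    intro x hx
    obtain ⟨y, hy, rfl⟩ := Finset.mem_image.mp hx
    rw [show W (N j + 1) = S' ^ N j * S' from pow_succ S' _]
    exact Finset.mul_mem_mul hy (Finset.mem_insert_of_mem hs)
  have h1 := Finset.card_le_card hsub
  rw [Finset.card_sdiff_of_subset (hWmono _)] at h1
  have h2 : (((W (N j)).image (· * s) \ W (N j)).card : ℝ) ≤
      (W (N j + 1)).card - (W (N j)).card := by
    rw [← Nat.cast_sub (Finset.card_le_card (hWmono _))]
    exact_mod_cast h1
  have h3 := hN j
  linarith

end Folner

/-! ### Finite averages of unitary conjugates. -/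

section ConjAverage

variable {G : Type*} [Group G] {D : Type*} [CStarAlgebra D]

/-- The average over the finite set `s` of the conjugates of `x` by the unitaries `π k`. -/
noncomputable def conjAverage (π : G →* unitary D) (s : Finset G) : D →ₗ[ℂ] D :=
  (s.card : ℂ)⁻¹ • ∑ k ∈ s, LinearMap.mulLeft ℂ (π k : D) ∘ₗ LinearMap.mulRight ℂ (star (π k : D))

variable (π : G →* unitary D) {s : Finset G}

lemma conjAverage_apply (s : Finset G) (x : D) :
    conjAverage π s x = (s.card : ℂ)⁻¹ • ∑ k ∈ s, (π k : D) * (x * star (π k : D)) := by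
  simp [conjAverage]

lemma norm_unitary_conj_le (u : unitary D) (x : D) : ‖(u : D) * (x * star (u : D))‖ ≤ ‖x‖ := by
  rw [CStarRing.norm_coe_unitary_mul, ← Unitary.coe_star, CStarRing.norm_mul_coe_unitary]

lemma norm_conjAverage_le (s : Finset G) (x : D) : ‖conjAverage π s x‖ ≤ ‖x‖ := by
  rcases s.eq_empty_or_nonempty with rfl | hs
  · simp [conjAverage_apply]
  have hc : (0 : ℝ) < s.card := Nat.cast_pos.mpr hs.card_pos
  rw [conjAverage_apply, norm_smul, norm_inv, Complex.norm_natCast, inv_mul_le_iff₀ hc]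
  refine (norm_sum_le_of_le s fun k _ => norm_unitary_conj_le (π k) x).trans ?_
  simp

lemma conjAverage_of_commute (hs : s.Nonempty) {x : D} (h : ∀ k ∈ s, Commute (π k : D) x) :
    conjAverage π s x = x := by
  have hc : (s.card : ℂ) ≠ 0 := Nat.cast_ne_zero.mpr hs.card_pos.ne'
  rw [conjAverage_apply, Finset.sum_congr rfl fun k hk => ?_, Finset.sum_const,
    ← Nat.cast_smul_eq_nsmul ℂ, inv_smul_smul₀ hc]
  rw [← mul_assoc, (h k hk).eq, mul_assoc,
    Unitary.mul_star_self_of_mem (π k).2, mul_one]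

/-- A Kadison–Schwarz inequality: with `m` the mean of the conjugates `y k` of `x`, the average of
`x* x` minus `m* m` is the variance, the mean of `(y k - m)* (y k - m)`, hence positive. -/
lemma sq_norm_conjAverage_le (s : Finset G) (x : D) :
    ‖conjAverage π s x‖ ^ 2 ≤ ‖conjAverage π s (star x * x)‖ := by
  rcases s.eq_empty_or_nonempty with rfl | hs
  · simp [conjAverage_apply]
  let _ : PartialOrder D := CStarAlgebra.spectralOrder D
  have : StarOrderedRing D := CStarAlgebra.spectralOrderedRing D
  have hc : (s.card : ℂ) ≠ 0 := Nat.cast_ne_zero.mpr hs.card_pos.ne'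
  set m := conjAverage π s x with hm
  let y : G → D := fun k => (π k : D) * (x * star (π k : D))
  have hsum : ∑ k ∈ s, y k = (s.card : ℂ) • m := by
    rw [hm, conjAverage_apply, smul_inv_smul₀ hc]
  have hsum' : ∑ k ∈ s, star (y k) = (s.card : ℂ) • star m := by
    rw [← star_sum, hsum, star_smul]; simp
  have hsq : ∀ k, star (y k) * y k = (π k : D) * ((star x * x) * star (π k : D)) := by
    intro k
    simp only [y, star_mul, star_star, mul_assoc]
    rw [← mul_assoc (star (π k : D)) (π k : D), Unitary.coe_star_mul_self, one_mul]
  have key : conjAverage π s (star x * x) - star m * m =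
      (s.card : ℂ)⁻¹ • ∑ k ∈ s, star (y k - m) * (y k - m) := by
    have h1 : ∑ k ∈ s, star (y k - m) * (y k - m) =
        ∑ k ∈ s, star (y k) * y k - (s.card : ℂ) • (star m * m) := by
      simp only [star_sub, sub_mul, mul_sub, Finset.sum_sub_distrib]
      rw [← Finset.sum_mul, ← Finset.mul_sum, hsum, hsum']
      simp [← Nat.cast_smul_eq_nsmul ℂ]
    rw [h1, smul_sub, inv_smul_smul₀ hc, conjAverage_apply]
    simp only [hsq]
  have hnonneg : 0 ≤ conjAverage π s (star x * x) - star m * m := by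
    rw [key]
    have h2 : (0 : D) ≤ ∑ k ∈ s, star (y k - m) * (y k - m) :=
      Finset.sum_nonneg fun k _ => star_mul_self_nonneg _
    have h3 : (s.card : ℂ)⁻¹ • ∑ k ∈ s, star (y k - m) * (y k - m) =
        ((s.card : ℝ)⁻¹ : ℝ) • ∑ k ∈ s, star (y k - m) * (y k - m) := by
      rw [← Complex.coe_smul]; push_cast; rfl
    rw [h3]
    exact smul_nonneg (by positivity) h2
  rw [sq, ← CStarRing.norm_star_mul_self]
  exact CStarAlgebra.norm_le_norm_of_nonneg_of_le (star_mul_self_nonneg m) (sub_nonneg.mp hnonneg)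

-- Conjugating `x` by `π t` translates the averaging set by `t` on the right. Only the symmetric
-- difference with `s` survives, and its two halves have equal size.
open Classical in
lemma norm_conjAverage_conj_sub_le (s : Finset G) (t : G) (x : D) :
    ‖conjAverage π s ((π t : D) * (x * star (π t : D))) - conjAverage π s x‖ ≤
      2 * ((s.image (· * t) \ s).card / s.card : ℝ) * ‖x‖ := by
  let y : G → D := fun k => (π k : D) * (x * star (π k : D))
  have hinj : Function.Injective (· * t : G → G) := mul_left_injective t
  have h1 : ∑ k ∈ s, (π k : D) * ((π t : D) * (x * star (π t : D)) * star (π k : D)) =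
      ∑ k ∈ s.image (· * t), y k := by
    rw [Finset.sum_image hinj.injOn]
    refine Finset.sum_congr rfl fun k _ => ?_
    simp only [y, map_mul, Submonoid.coe_mul, star_mul, mul_assoc]
  have hcard : (s \ s.image (· * t)).card = (s.image (· * t) \ s).card :=
    Finset.card_sdiff_comm (Finset.card_image_of_injective s hinj).symm
  have h2 : ∑ k ∈ s.image (· * t), y k - ∑ k ∈ s, y k =
      ∑ k ∈ s.image (· * t) \ s, y k - ∑ k ∈ s \ s.image (· * t), y k := by
    rw [sub_eq_sub_iff_add_eq_add, ← Finset.sum_inter_add_sum_sdiff (s.image (· * t)) s,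
      ← Finset.sum_inter_add_sum_sdiff s (s.image (· * t)), Finset.inter_comm]
    abel
  rw [conjAverage_apply, conjAverage_apply, ← smul_sub, h1, h2, norm_smul, norm_inv,
    Complex.norm_natCast]
  have h3 : ∀ r : Finset G, ‖∑ k ∈ r, y k‖ ≤ r.card * ‖x‖ := fun r => by
    refine (norm_sum_le_of_le r fun k _ => norm_unitary_conj_le (π k) x).trans ?_
    simp
  calc (s.card : ℝ)⁻¹ * ‖∑ k ∈ s.image (· * t) \ s, y k - ∑ k ∈ s \ s.image (· * t), y k‖
      ≤ (s.card : ℝ)⁻¹ * ((s.image (· * t) \ s).card * ‖x‖ + (s \ s.image (· * t)).card * ‖x‖) := by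
        gcongr
        exact (norm_sub_le _ _).trans (add_le_add (h3 _) (h3 _))
    _ = _ := by rw [hcard]; ring

end ConjAverage

/-! ### Asymptotically invariant averages and the van der Corput trick. -/

section AsymptoticAverage

open Filter Topology

variable {G : Type*} [Group G] {D : Type*} [CStarAlgebra D]

/-- A sequence of averages over conjugations by unitaries in `π(K)` which is asymptotically
invariant under conjugation by `π(K)`. -/
structure AsymptoticAverage (π : G →* unitary D) (K : Subgroup G) where
  toFun : ℕ → D →ₗ[ℂ] D
  norm_le : ∀ j x, ‖toFun j x‖ ≤ ‖x‖
  apply_of_commute : ∀ j x, (∀ k ∈ K, Commute (π k : D) x) → toFun j x = x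
  sq_norm_le : ∀ j x, ‖toFun j x‖ ^ 2 ≤ ‖toFun j (star x * x)‖
  tendsto_conj_sub : ∀ k ∈ K, ∀ x,
    Tendsto (fun j => toFun j ((π k : D) * (x * star (π k : D))) - toFun j x) atTop (𝓝 0)

/-- Følner sets of `K` give asymptotic invariance under generators, and the elements for which it
holds for all `x` are closed under products and inverses. -/
lemma exists_asymptoticAverage (π : G →* unitary D) (K : Subgroup G) [Group.FG K]
    [Group.IsNilpotent K] : Nonempty (AsymptoticAverage π K) := by
  classical
  obtain ⟨B, hB, S, hS, hlim⟩ := exists_folner_sequence K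
  let ρ := π.comp K.subtype
  let A := fun j => conjAverage ρ (B j)
  have hgen : ∀ s ∈ S, ∀ x : D,
      Tendsto (fun j => A j ((ρ s : D) * (x * star (ρ s : D))) - A j x) atTop (𝓝 0) := by
    intro s hs x
    have h := ((hlim s hs).const_mul 2).mul_const ‖x‖
    rw [mul_zero, zero_mul] at h
    exact squeeze_zero_norm (fun j => norm_conjAverage_conj_sub_le ρ (B j) s x) h
  have hall : ∀ k : K, ∀ x : D,
      Tendsto (fun j => A j ((ρ k : D) * (x * star (ρ k : D))) - A j x) atTop (𝓝 0) := by
    intro k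
    have hk : k ∈ Subgroup.closure S := by rw [hS]; trivial
    induction hk using Subgroup.closure_induction with
    | mem s hs => exact hgen s hs
    | one => intro x; simp
    | mul a b _ _ ha hb =>
      intro x
      have h := (ha ((ρ b : D) * (x * star (ρ b : D)))).add (hb x)
      rw [add_zero] at h
      refine h.congr fun j => ?_
      simp [mul_assoc]
    | inv a _ ha =>
      intro x
      have h := (ha ((ρ a⁻¹ : D) * (x * star (ρ a⁻¹ : D)))).neg
      rw [neg_zero] at h
      refine h.congr fun j => ?_
      have e : (ρ a : D) * ((ρ a⁻¹ : D) * (x * star (ρ a⁻¹ : D)) * star (ρ a : D)) = x := by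
        have h1 : (ρ a : D) * (ρ a⁻¹ : D) = 1 := by
          rw [← Submonoid.coe_mul, ← map_mul, mul_inv_cancel, map_one]; rfl
        have h2 : star (ρ a⁻¹ : D) * star (ρ a : D) = 1 := by rw [← star_mul, h1, star_one]
        rw [← mul_assoc, ← mul_assoc, h1, one_mul, mul_assoc, h2, mul_one]
      rw [e, neg_sub]
  refine ⟨⟨A, fun j x => norm_conjAverage_le ρ _ x, fun j x h =>
    conjAverage_of_commute ρ (hB j) fun k _ => h k k.2, fun j x => sq_norm_conjAverage_le ρ _ x,
    fun k hk x => hall ⟨k, hk⟩ x⟩⟩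

namespace AsymptoticAverage

variable {π : G →* unitary D} {K : Subgroup G}

lemma tendsto_conj_sub_coe (A : AsymptoticAverage π K) {k : G} (hk : k ∈ K) (g : G) :
    Tendsto (fun j => A.toFun j (π (k * g * k⁻¹) : D) - A.toFun j (π g : D)) atTop (𝓝 0) := by
  have h := A.tendsto_conj_sub k hk (π g : D)
  have e : (π (k * g * k⁻¹) : D) = (π k : D) * ((π g : D) * star (π k : D)) := by
    rw [map_mul, map_mul, map_inv, mul_assoc]; rfl
  rwa [e]

lemma toFun_one (A : AsymptoticAverage π K) (j : ℕ) : A.toFun j 1 = 1 :=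
  A.apply_of_commute j 1 fun _ _ => Commute.one_right _

/-- The van der Corput argument: if arbitrarily many conjugates `u` of `g` have all the products
`u⁻¹ u'` averaging to zero, then so does `g`. -/
lemma tendsto_zero_of_conjugates (A : AsymptoticAverage π K) {g : G}
    (h : ∀ n : ℕ, ∃ t : Finset K, t.card = n ∧ ∀ a ∈ t, ∀ b ∈ t, a ≠ b →
      Tendsto (fun j => A.toFun j (π (((a : G) * g * (a : G)⁻¹)⁻¹ * (b * g * (b : G)⁻¹)) : D))
        atTop (𝓝 0)) :
    Tendsto (fun j => A.toFun j (π g : D)) atTop (𝓝 0) := by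
  classical
  rw [Metric.tendsto_atTop']
  simp only [dist_zero_right]
  suffices H : ∀ ε > 0, ∀ᶠ j in atTop, ‖A.toFun j (π g : D)‖ < ε by
    intro ε hε
    obtain ⟨N, hN⟩ := eventually_atTop.mp (H ε hε)
    exact ⟨N, fun n hn => hN n hn.le⟩
  intro ε hε
  -- Chosen so that `1/n < (ε/2)²`, where `1/n` will be the limit of the averages of `m* m`.
  obtain ⟨n, hn⟩ := exists_nat_gt ((ε / 2) ^ 2)⁻¹
  have hn0 : (0 : ℝ) < n := lt_of_le_of_lt (by positivity) hn
  have hnC : (n : ℂ) ≠ 0 := by exact_mod_cast hn0.ne'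
  have hnε : (n : ℝ)⁻¹ < (ε / 2) ^ 2 := inv_lt_of_inv_lt₀ (by positivity) hn
  obtain ⟨t, htn, ht⟩ := h n
  let w : K → G := fun a => (a : G) * g * (a : G)⁻¹
  let m : D := (n : ℂ)⁻¹ • ∑ a ∈ t, (π (w a) : D)
  have hm : Tendsto (fun j => A.toFun j m - A.toFun j (π g : D)) atTop (𝓝 0) := by
    have h1 : Tendsto (fun j => (n : ℂ)⁻¹ • ∑ a ∈ t,
        (A.toFun j (π (w a) : D) - A.toFun j (π g : D))) atTop (𝓝 0) := by
      have := (tendsto_finsetSum t fun a (_ : a ∈ t) =>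
        A.tendsto_conj_sub_coe a.2 g).const_smul (n : ℂ)⁻¹
      rwa [Finset.sum_const_zero, smul_zero] at this
    refine h1.congr fun j => ?_
    rw [Finset.sum_sub_distrib, smul_sub, Finset.sum_const, htn, ← Nat.cast_smul_eq_nsmul ℂ,
      inv_smul_smul₀ hnC, map_smul, map_sum]
  -- In the double sum for `m* m` the off-diagonal terms average to zero, and the `n` diagonal terms
  -- equal `1` against the factor `n⁻²`.
  have hsq : Tendsto (fun j => A.toFun j (star m * m)) atTop (𝓝 ((n : ℂ)⁻¹ • 1)) := by
    have e : star m * m = ((n : ℂ)⁻¹ * (n : ℂ)⁻¹) • ∑ a ∈ t, ∑ b ∈ t, (π ((w a)⁻¹ * w b) : D) := by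
      simp only [m, star_smul, star_sum, smul_mul_smul_comm, Finset.sum_mul_sum, map_mul, map_inv]
      congr 1
      simp
    have h1 : Tendsto (fun j => ((n : ℂ)⁻¹ * (n : ℂ)⁻¹) •
        ∑ a ∈ t, ∑ b ∈ t, A.toFun j (π ((w a)⁻¹ * w b) : D)) atTop
        (𝓝 (((n : ℂ)⁻¹ * (n : ℂ)⁻¹) • ∑ a ∈ t, ∑ b ∈ t, if a = b then (1 : D) else 0)) := by
      refine Tendsto.const_smul (tendsto_finsetSum _ fun a ha =>
        tendsto_finsetSum _ fun b hb => ?_) _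
      split_ifs with hab
      · subst hab
        simp only [inv_mul_cancel, map_one, OneMemClass.coe_one, A.toFun_one]
        exact tendsto_const_nhds
      · exact ht a ha b hb hab
    have e2 : ((n : ℂ)⁻¹ * (n : ℂ)⁻¹) • ∑ a ∈ t, ∑ b ∈ t, (if a = b then (1 : D) else 0) =
        (n : ℂ)⁻¹ • 1 := by
      simp only [Finset.sum_ite_eq, Finset.sum_ite_mem, Finset.inter_self, Finset.sum_const, htn]
      rw [← Nat.cast_smul_eq_nsmul ℂ, smul_smul, mul_assoc, inv_mul_cancel₀ hnC, mul_one]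
    rw [e2] at h1
    refine h1.congr fun j => ?_
    rw [e, map_smul, map_sum]
    simp only [map_sum]
  have hlt : ‖(n : ℂ)⁻¹ • (1 : D)‖ < (ε / 2) ^ 2 := by
    refine lt_of_le_of_lt ?_ hnε
    rw [norm_smul, norm_inv, Complex.norm_natCast]
    refine mul_le_of_le_one_right (by positivity) ?_
    rcases subsingleton_or_nontrivial D with _ | _
    · simp [Subsingleton.elim (1 : D) 0]
    · exact CStarRing.norm_one.le
  filter_upwards [hsq.norm.eventually (gt_mem_nhds hlt),
    (tendsto_zero_iff_norm_tendsto_zero.mp hm).eventually (gt_mem_nhds (half_pos hε))] with j h1 h2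
  have h3 : ‖A.toFun j m‖ < ε / 2 :=
    lt_of_pow_lt_pow_left₀ 2 (by positivity) ((A.sq_norm_le j m).trans_lt h1)
  calc ‖A.toFun j (π g : D)‖ = ‖A.toFun j m - (A.toFun j m - A.toFun j (π g : D))‖ := by
        rw [sub_sub_cancel]
    _ ≤ ‖A.toFun j m‖ + ‖A.toFun j m - A.toFun j (π g : D)‖ := norm_sub_le _ _
    _ < ε := by linarith

end AsymptoticAverage

end AsymptoticAverage

/-! ### Averages vanish outside the FC-centre. -/

section NilpotentConjugates

variable {G : Type*} [Group G] [Group.FG G] [Group.IsNilpotent G]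

/-- Each class modulo the FC-centre splits into finitely many classes modulo the centre. -/
lemma finite_image_of_finite_mod_fcCenter {X : Set G}
    (hX : ((QuotientGroup.mk : G → G ⧸ fcCenter G) '' X).Finite) :
    ((QuotientGroup.mk : G → G ⧸ Subgroup.center G) '' X).Finite := by
  obtain ⟨X₀, -, hbij⟩ := Set.SurjOn.exists_bijOn_subset
    (Set.surjOn_image (QuotientGroup.mk : G → G ⧸ fcCenter G) X)
  have hX₀ : X₀.Finite := hbij.finite_iff_finite.mpr hX
  refine ((hX₀.image (QuotientGroup.mk : G → G ⧸ Subgroup.center G)).image2 (· * ·)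
    (finite_fcCenter_mod_center G)).subset ?_
  rintro _ ⟨x, hx, rfl⟩
  obtain ⟨x₀, hx₀, he⟩ := hbij.surjOn ⟨x, hx, rfl⟩
  refine ⟨_, ⟨x₀, hx₀, rfl⟩, _, ⟨x₀⁻¹ * x, QuotientGroup.eq.mp he, rfl⟩, ?_⟩
  change ((x₀ * (x₀⁻¹ * x) : G) : G ⧸ Subgroup.center G) = x
  rw [mul_inv_cancel_left]

/-- If conjugation by `K` never multiplies `g ∉ fcCenter G` by a nontrivial central element, then
the `K`-conjugates of `g` occupy infinitely many cosets of the FC-centre. -/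
lemma infinite_conjugates_mod_fcCenter (K : Subgroup G) [K.FiniteIndex] {g : G}
    (hg : g ∉ fcCenter G)
    (hK : ∀ h ∈ K, h * g * h⁻¹ * g⁻¹ ∈ Subgroup.center G → h * g * h⁻¹ = g) :
    (Set.range fun h : K => (QuotientGroup.mk ((h : G) * g * (h : G)⁻¹) : G ⧸ fcCenter G)).Infinite := by
  intro hfin
  apply hg
  have h1 : ((QuotientGroup.mk : G → G ⧸ Subgroup.center G) ''
      (Set.range fun h : K => (h : G) * g * (h : G)⁻¹)).Finite := by
    apply finite_image_of_finite_mod_fcCenter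
    rwa [← Set.range_comp]
  rw [← Set.range_comp] at h1
  have := h1.to_subtype
  let C := (Subgroup.centralizer {g}).subgroupOf K
  have hC : C.FiniteIndex := by
    rw [Subgroup.finiteIndex_iff_finite_quotient]
    let φ : K ⧸ C → Set.range ((QuotientGroup.mk : G → G ⧸ Subgroup.center G) ∘
        fun h : K => (h : G) * g * (h : G)⁻¹) :=
      fun q => ⟨_, ⟨q.out, rfl⟩⟩
    -- If the conjugates by `x` and `y` agree modulo the centre, the commutator of `x⁻¹ y` with `g`
    -- is central, so by `hK` it is trivial and `x`, `y` lie in one coset of the centralizer.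
    refine Finite.of_injective φ fun a b hab => ?_
    have hz := QuotientGroup.eq.mp (congrArg Subtype.val hab)
    rw [← Quotient.out_eq' a, ← Quotient.out_eq' b]
    set x := Quotient.out a
    set y := Quotient.out b
    refine QuotientGroup.eq.mpr ?_
    rw [Subgroup.mem_subgroupOf, Subgroup.mem_centralizer_singleton_iff]
    have hz2 : ((x⁻¹ * y : K) : G) * g * ((x⁻¹ * y : K) : G)⁻¹ * g⁻¹ ∈ Subgroup.center G := by
      have hc := Subgroup.Normal.conj_mem (inferInstance : (Subgroup.center G).Normal) _ hz
        (g * (x : G)⁻¹)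
      have hc2 := Subgroup.Normal.conj_mem (inferInstance : (Subgroup.center G).Normal) _ hc g⁻¹
      have hc3 := Subgroup.Normal.conj_mem (inferInstance : (Subgroup.center G).Normal) _ hc2 g
      convert hc3 using 1
      push_cast
      group
    have h2 := hK _ (x⁻¹ * y).2 hz2
    exact mul_inv_eq_iff_eq_mul.mp h2
  have hle : Subgroup.centralizer {g} ⊓ K ≤ Subgroup.centralizer {g} := inf_le_left
  have : (Subgroup.centralizer {g} ⊓ K).FiniteIndex := by
    refine ⟨?_⟩
    rw [← Subgroup.relIndex_mul_index inf_le_right, Subgroup.inf_relIndex_right]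
    exact mul_ne_zero hC.index_ne_zero Subgroup.FiniteIndex.index_ne_zero
  exact Subgroup.finiteIndex_of_le hle

open Filter Topology

variable {D : Type*} [CStarAlgebra D] {π : G →* unitary D}

/-- If `π` is faithful and scalar on the centre, the averages over conjugates by `K` of `π g` tend
to zero in norm for all `g` outside the FC-centre. -/
theorem AsymptoticAverage.tendsto_zero {K : Subgroup G} [K.FiniteIndex]
    (A : AsymptoticAverage π K) (hinj : Function.Injective π)
    (hscalar : ∀ z ∈ Subgroup.center G, ∃ c : ℂ, (π z : D) = c • 1) {g : G}
    (hg : g ∉ fcCenter G) : Tendsto (fun j => A.toFun j (π g : D)) atTop (𝓝 0) := by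
  classical
  suffices H : ∀ m, ∀ g ∈ Subgroup.upperCentralSeries G m, g ∉ fcCenter G →
      Tendsto (fun j => A.toFun j (π g : D)) atTop (𝓝 0) by
    obtain ⟨m, hm⟩ := Group.IsNilpotent.nilpotent G
    exact H m g (by rw [hm]; trivial) hg
  intro m
  induction m with
  | zero =>
    intro g hgm hg
    rw [Subgroup.upperCentralSeries_zero, Subgroup.mem_bot] at hgm
    exact absurd (hgm ▸ one_mem _) hg
  | succ m ih =>
    intro g hgm hg
    by_cases hK : ∀ h ∈ K, h * g * h⁻¹ * g⁻¹ ∈ Subgroup.center G → h * g * h⁻¹ = g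
    · refine A.tendsto_zero_of_conjugates fun n => ?_
      obtain ⟨t, ht, htn⟩ := (infinite_conjugates_mod_fcCenter K hg hK).exists_subset_card_eq n
      choose! r hr using fun q (hq : q ∈ t) => ht hq
      refine ⟨t.image r, ?_, ?_⟩
      · rw [Finset.card_image_of_injOn, htn]
        intro a ha b hb hab
        rw [← hr a ha, ← hr b hb, hab]
      · intro a ha b hb hab
        obtain ⟨p, hp, rfl⟩ := Finset.mem_image.mp ha
        obtain ⟨q, hq, rfl⟩ := Finset.mem_image.mp hb
        -- Both conjugates are congruent to `g` modulo the `m`-th term, so their quotient lies in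
        -- it; it is outside the FC-centre because the cosets are distinct.
        refine ih _ ?_ fun hF => ?_
        · have hcomm : ∀ h : G, h * g * h⁻¹ * g⁻¹ ∈ Subgroup.upperCentralSeries G m := by
            intro h
            have := inv_mem (Subgroup.mem_upperCentralSeries_succ_iff.mp hgm h)
            simpa [commutatorElement_def, mul_assoc] using this
          have := Subgroup.Normal.conj_mem (inferInstance :
            (Subgroup.upperCentralSeries G m).Normal) _
            (mul_mem (inv_mem (hcomm (r p))) (hcomm (r q))) g⁻¹
          convert this using 1
          group
        · have := QuotientGroup.eq.mpr hF
          exact hab (congrArg r ((hr p hp).symm.trans (this.trans (hr q hq))))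
    -- Now some conjugate of `g` by `K` is a nontrivial central multiple of `g`, so `π` multiplies
    -- `π g` by a scalar `c`, with `c ≠ 1` by faithfulness. Asymptotic invariance gives `(c - 1)
    -- A_j(π g) → 0`.
    · push Not at hK
      obtain ⟨h, hh, hz, hne⟩ := hK
      obtain ⟨c, hc⟩ := hscalar _ hz
      have hc1 : c - 1 ≠ 0 := by
        intro h1
        rw [sub_eq_zero.mp h1, one_smul] at hc
        have h2 : π (h * g * h⁻¹ * g⁻¹) = π 1 := by rw [map_one]; exact Subtype.ext hc
        exact hne (mul_inv_eq_one.mp (hinj h2))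
      have h1 := (A.tendsto_conj_sub_coe hh g).const_smul (c - 1)⁻¹
      rw [smul_zero] at h1
      refine h1.congr fun j => ?_
      have e : (π (h * g * h⁻¹) : D) = c • (π g : D) := by
        rw [show h * g * h⁻¹ = h * g * h⁻¹ * g⁻¹ * g by group, map_mul, Submonoid.coe_mul, hc,
          smul_one_mul]
      rw [e, map_smul, ← one_smul ℂ (A.toFun j (π g : D)), smul_smul, ← sub_smul, mul_one, inv_smul_smul₀ hc1, one_smul]

open Classical in
/-- If `π` is faithful and scalar on the centre, restricting coefficients to the FC-centre is
contractive. -/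
theorem norm_sum_filter_fcCenter_le (hinj : Function.Injective π)
    (hscalar : ∀ z ∈ Subgroup.center G, ∃ c : ℂ, (π z : D) = c • 1) (T : Finset G) (c : G → ℂ) :
    ‖∑ x ∈ T with x ∈ fcCenter G, c x • (π x : D)‖ ≤ ‖∑ x ∈ T, c x • (π x : D)‖ := by
  -- This subgroup has finite index, as the vanishing of averages requires, yet commutes with the
  -- FC-centre, so the averages fix `a`.
  let K := Subgroup.centralizer (fcCenter G : Set G)
  have : Group.FG K := (Group.fg_iff_subgroup_fg _).mpr (Subgroup.fg_of_nilpotent _)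
  obtain ⟨A⟩ := exists_asymptoticAverage π K
  set a := ∑ x ∈ T with x ∈ fcCenter G, c x • (π x : D)
  have hfix : ∀ j, A.toFun j a = a := by
    refine fun j => A.apply_of_commute j a fun k hk => ?_
    refine Commute.sum_right _ _ _ fun x hx => Commute.smul_right ?_ _
    have h := Subgroup.mem_centralizer_iff.mp hk x (Finset.mem_filter.mp hx).2
    change (π k : D) * (π x : D) = π x * π k
    rw [← Submonoid.coe_mul, ← Submonoid.coe_mul, ← map_mul, ← map_mul, h]
  have hlim : Tendsto (fun j => A.toFun j (∑ x ∈ T, c x • (π x : D))) atTop (𝓝 a) := by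
    have h0 : Tendsto (fun j => ∑ x ∈ T with x ∉ fcCenter G, c x • A.toFun j (π x : D))
        atTop (𝓝 0) := by
      have := tendsto_finsetSum (T.filter fun x => x ∉ fcCenter G) fun x hx =>
        (A.tendsto_zero hinj hscalar (Finset.mem_filter.mp hx).2).const_smul (c x)
      simpa using this
    have h1 := h0.const_add a
    rw [add_zero] at h1
    refine h1.congr fun j => ?_
    rw [← Finset.sum_filter_add_sum_filter_not T (fun x => x ∈ fcCenter G), map_add, hfix, map_sum]
    simp only [map_smul]
  exact le_of_tendsto' hlim.norm fun j => A.norm_le j _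

end NilpotentConjugates

/-! ### Finite-dimensional algebras and removal of polynomial factors. -/

section FiniteDimensional

open Filter Topology

/-- A finite-dimensional *-subalgebra of a C*-algebra has a unit. -/
lemma NonUnitalStarSubalgebra.exists_unit_of_finiteDimensional {B : Type*} [CStarAlgebra B]
    (J : NonUnitalStarSubalgebra ℂ B) [FiniteDimensional ℂ J] :
    ∃ q ∈ J, IsStarProjection q ∧ ∀ x ∈ J, q * x = x ∧ x * q = x := by
  have hclosed : IsClosed (J : Set B) :=
    have : FiniteDimensional ℂ J.toSubmodule := ‹FiniteDimensional ℂ J›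
    J.toSubmodule.closed_of_finiteDimensional
  let _ : NonUnitalCStarAlgebra J :=
    NonUnitalStarSubalgebra.nonUnitalCStarAlgebra J (h_closed := hclosed)
  let _ : PartialOrder J := CStarAlgebra.spectralOrder J
  have : StarOrderedRing J := CStarAlgebra.spectralOrderedRing J
  have : ProperSpace J := FiniteDimensional.proper ℂ J
  have hl := CStarAlgebra.increasingApproximateUnit (A := J)
  -- The approximate unit lives in the closed unit ball, which is compact here; a limit along an
  -- ultrafilter is an honest unit.
  set U := Ultrafilter.of (CStarAlgebra.approximateUnit J)
  have hUl : (U : Filter J) ≤ CStarAlgebra.approximateUnit J := Ultrafilter.of_le _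
  obtain ⟨e, -, he⟩ := (isCompact_closedBall (0 : J) 1).ultrafilter_le_nhds U
    (le_principal_iff.mpr (hUl hl.closedBall_mem))
  have hle : ∀ x : J, x * e = x := fun x =>
    tendsto_nhds_unique ((continuous_const_mul x).tendsto e |>.mono_left he)
      ((hl.tendsto_mul_left x).mono_left hUl)
  have hre : ∀ x : J, e * x = x := fun x =>
    tendsto_nhds_unique ((continuous_mul_const x).tendsto e |>.mono_left he)
      ((hl.tendsto_mul_right x).mono_left hUl)
  have hstar : star e = e := by
    have h1 := hle (star e)
    have h2 := congrArg star h1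
    rw [star_mul, star_star, h1] at h2
    exact h2
  refine ⟨e, e.2, ⟨congrArg Subtype.val (hle e), congrArg Subtype.val hstar⟩, fun x hx =>
    ⟨congrArg Subtype.val (hre ⟨x, hx⟩), congrArg Subtype.val (hle ⟨x, hx⟩)⟩⟩

/-- `S` factors through the range of `T`, and a linear map on a finite-dimensional space is bounded.
-/
lemma LinearMap.exists_norm_le_of_ker_le {V E F : Type*} [AddCommGroup V] [Module ℂ V]
    [FiniteDimensional ℂ V] [NormedAddCommGroup E] [NormedSpace ℂ E] [NormedAddCommGroup F]
    [NormedSpace ℂ F] (S : V →ₗ[ℂ] E) (T : V →ₗ[ℂ] F) (h : T.ker ≤ S.ker) :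
    ∃ C : ℝ, 0 ≤ C ∧ ∀ v, ‖S v‖ ≤ C * ‖T v‖ := by
  let R : T.range →ₗ[ℂ] E := (T.ker.liftQ S h) ∘ₗ T.quotKerEquivRange.symm.toLinearMap
  refine ⟨‖R.toContinuousLinearMap‖, ContinuousLinearMap.opNorm_nonneg _, fun v => ?_⟩
  have h1 := R.toContinuousLinearMap.le_opNorm ⟨T v, v, rfl⟩
  have h2 : R ⟨T v, v, rfl⟩ = S v := by
    have : T.quotKerEquivRange.symm ⟨T v, v, rfl⟩ = T.ker.mkQ v :=
      (LinearEquiv.symm_apply_eq _).mpr rfl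
    simp [R, this]
  simpa [h2] using h1

/-- If `y < x`, the exponential decay of `(y/x)^(2^k)` beats any polynomial in `2^k`. -/
lemma le_of_pow_le_polynomial_mul_pow {x y C : ℝ} {d : ℕ} (hy : 0 ≤ y) (hC : 0 ≤ C)
    (h : ∀ k : ℕ, x ^ (2 ^ k) ≤ C * (2 ^ k + 1) ^ d * y ^ (2 ^ k)) : x ≤ y := by
  by_contra! hlt
  have hx0 : 0 < x := hy.trans_lt hlt
  have hr : |y / x| < 1 := by
    rw [abs_of_nonneg (by positivity), div_lt_one hx0]; exact hlt
  have h1 := ((tendsto_pow_const_mul_const_pow_of_abs_lt_one d hr).comp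
    (tendsto_pow_atTop_atTop_of_one_lt (one_lt_two (α := ℕ)))).const_mul (C * 2 ^ d)
  rw [mul_zero] at h1
  obtain ⟨k, hk⟩ := (h1.eventually (gt_mem_nhds one_pos)).exists
  have h2 := h k
  have h3 : ((2 : ℝ) ^ k + 1) ^ d ≤ (2 * 2 ^ k) ^ d := by
    gcongr
    have : (1 : ℝ) ≤ 2 ^ k := one_le_pow₀ one_le_two
    linarith
  have h4 : C * (2 ^ k + 1) ^ d * y ^ (2 ^ k) ≤ C * (2 * 2 ^ k) ^ d * y ^ (2 ^ k) := by gcongr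
  simp only [Function.comp_apply, Nat.cast_pow, Nat.cast_ofNat, div_pow] at hk
  have h5 : C * (2 * 2 ^ k) ^ d * y ^ (2 ^ k) < x ^ (2 ^ k) := by
    have hxp : 0 < x ^ (2 ^ k) := by positivity
    calc C * (2 * 2 ^ k) ^ d * y ^ (2 ^ k)
        = (C * 2 ^ d * ((2 ^ k) ^ d * (y ^ 2 ^ k / x ^ 2 ^ k))) * x ^ (2 ^ k) := by
          rw [mul_pow]; field_simp
      _ < 1 * x ^ (2 ^ k) := by gcongr
      _ = _ := one_mul _
  linarith

/-- Translates word growth in the group into growth of supports of powers. -/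
lemma pow_mem_span_of_lists {G B : Type*} [Group G] [CStarAlgebra B] {u : G →* unitary B} {S : Finset G} {b : B}
    (hb : b ∈ Submodule.span ℂ ((fun g => (u g : B)) '' (S : Set G))) (n : ℕ) :
    b ^ n ∈ Submodule.span ℂ ((fun g => (u g : B)) ''
      {g | ∃ l : List G, l.length ≤ n ∧ (∀ x ∈ l, x ∈ S) ∧ l.prod = g}) := by
  induction n with
  | zero => exact Submodule.subset_span ⟨1, ⟨[], by simp⟩, by simp⟩
  | succ n ih =>
    rw [pow_succ']
    have h := Submodule.mul_mem_mul hb ih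
    rw [Submodule.span_mul_span] at h
    refine Submodule.span_mono ?_ h
    rintro _ ⟨_, ⟨x, hx, rfl⟩, _, ⟨_, ⟨l, hl, hlS, rfl⟩, rfl⟩, rfl⟩
    refine ⟨x * l.prod, ⟨x :: l, by simpa using hl, ?_, by simp⟩, by simp⟩
    intro y hy
    rcases List.mem_cons.mp hy with rfl | hy
    · exact hx
    · exact hlS y hy

end FiniteDimensional

/-! ### The central projection cutting out the kernel. -/

section FiniteIndex

variable {G : Type*} [Group G] [Group.FG G] [Group.IsNilpotent G]

lemma relIndex_center_fcCenter_ne_zero : (Subgroup.center G).relIndex (fcCenter G) ≠ 0 := by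
  have := (finite_fcCenter_mod_center G).to_subtype
  have : Finite (fcCenter G ⧸ (Subgroup.center G).subgroupOf (fcCenter G)) := by
    refine Finite.of_injective (β := (QuotientGroup.mk : G → G ⧸ Subgroup.center G) ''
      (fcCenter G : Set G)) (fun q => ⟨_, _, q.out.2, rfl⟩) fun a b hab => ?_
    rw [← Quotient.out_eq' a, ← Quotient.out_eq' b]
    have h : (QuotientGroup.mk (a.out : G) : G ⧸ Subgroup.center G) = (b.out : G) :=
      congrArg Subtype.val hab
    have h' := QuotientGroup.eq.mp h
    exact QuotientGroup.eq.mpr h'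
  exact (Subgroup.finiteIndex_of_finite_quotient).index_ne_zero

variable {B : Type*} [CStarAlgebra B] (u : G →* unitary B)

/-- The span of the unitaries `u f` for `f` in the FC-centre. -/
noncomputable def fcSpan : Submodule ℂ B := Submodule.span ℂ ((fun g => (u g : B)) '' (fcCenter G : Set G))

variable {u}

/-- `N` has finite index in the FC-centre, and `u` changes only by a scalar along a coset of `N`. -/
lemma finiteDimensional_fcSpan {N : Subgroup G} (hN : N ≤ Subgroup.center G)
    (hfin : N.IsFiniteRelIndex (Subgroup.center G))
    (hscalar : ∀ n ∈ N, ∃ c : ℂ, (u n : B) = c • 1) : FiniteDimensional ℂ (fcSpan u) := by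
  have hidx : N.relIndex (fcCenter G) ≠ 0 := by
    rw [← Subgroup.relIndex_mul_relIndex N _ _ hN center_le_fcCenter]
    exact mul_ne_zero hfin.relIndex_ne_zero relIndex_center_fcCenter_ne_zero
  have : (N.subgroupOf (fcCenter G)).FiniteIndex := ⟨hidx⟩
  have : Finite (fcCenter G ⧸ N.subgroupOf (fcCenter G)) :=
    Subgroup.finite_quotient_of_finiteIndex
  have : FiniteDimensional ℂ (Submodule.span ℂ (Set.range
      fun q : fcCenter G ⧸ N.subgroupOf (fcCenter G) => (u (q.out : G) : B))) :=
    FiniteDimensional.span_of_finite ℂ (Set.finite_range _)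
  refine Submodule.finiteDimensional_of_le (S₂ := Submodule.span ℂ (Set.range
    fun q : fcCenter G ⧸ N.subgroupOf (fcCenter G) => (u (q.out : G) : B))) ?_
  refine Submodule.span_le.mpr ?_
  rintro _ ⟨g, hg, rfl⟩
  let f : fcCenter G := ⟨g, hg⟩
  have h := QuotientGroup.eq.mp (QuotientGroup.out_eq'
    (QuotientGroup.mk f : fcCenter G ⧸ N.subgroupOf (fcCenter G)))
  obtain ⟨c, hc⟩ := hscalar _ (Subgroup.mem_subgroupOf.mp h)
  set r := (QuotientGroup.mk f : fcCenter G ⧸ N.subgroupOf (fcCenter G)).out with hr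
  have e : (u g : B) = c • (u (r : G) : B) := by
    have : g = (r : G) * ((r⁻¹ * f : fcCenter G) : G) := by simp [f]
    rw [this, map_mul, Submonoid.coe_mul, hc, mul_smul_one]
  change (u g : B) ∈ _
  rw [e]
  exact Submodule.smul_mem _ _ (Submodule.subset_span ⟨_, rfl⟩)

open Classical in
/-- A bound on `S ↦ ‖p a‖ / ‖ev a‖` which is linear in the size of the support of `a`. -/
lemma norm_mul_le_card_mul {D : Type*} [CStarAlgebra D] (ev : B →⋆ₐ[ℂ] D) {π : G →* unitary D}
    (hπ : ∀ g, (π g : D) = ev (u g)) (hinj : Function.Injective π)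
    (hscalar : ∀ z ∈ Subgroup.center G, ∃ c : ℂ, (π z : D) = c • 1) {p : B}
    (hp : ∀ g, Commute p (u g : B)) {C : ℝ} (hC : 0 ≤ C)
    (hbound : ∀ b ∈ fcSpan u, ‖p * b‖ ≤ C * ‖ev b‖) (T : Finset G) (c : G → ℂ) :
    ‖p * ∑ x ∈ T, c x • (u x : B)‖ ≤ T.card * (C * ‖ev (∑ x ∈ T, c x • (u x : B))‖) := by
  set a := ∑ x ∈ T, c x • (u x : B) with ha
  let q : G → G ⧸ fcCenter G := QuotientGroup.mk
  -- Translating by `u g⁻¹`, which commutes with `p` and preserves norms, moves the coset of `g`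
  -- onto the FC-centre, where `hbound` and the contractive restriction apply.
  have hpart : ∀ κ ∈ T.image q, ‖p * ∑ x ∈ T with q x = κ, c x • (u x : B)‖ ≤ C * ‖ev a‖ := by
    intro κ hκ
    obtain ⟨g, -, rfl⟩ := Finset.mem_image.mp hκ
    have hT : T = (T.image (g⁻¹ * ·)).image (g * ·) := by
      rw [Finset.image_image]; simp
    have hinjg : Function.Injective (g * · : G → G) := mul_right_injective g
    set T' := T.image (g⁻¹ * ·)
    have hug : ∀ y, (u g⁻¹ : B) * (u (g * y) : B) = u y := by
      intro y
      rw [← Submonoid.coe_mul, ← map_mul, inv_mul_cancel_left]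
    have hsum : (u g⁻¹ : B) * a = ∑ y ∈ T', c (g * y) • (u y : B) := by
      rw [ha, hT, Finset.sum_image hinjg.injOn, Finset.mul_sum]
      exact Finset.sum_congr rfl fun y _ => by rw [mul_smul_comm, hug]
    have hsum2 : (u g⁻¹ : B) * ∑ x ∈ T with q x = q g, c x • (u x : B) =
        ∑ y ∈ T' with y ∈ fcCenter G, c (g * y) • (u y : B) := by
      rw [hT, Finset.filter_image, Finset.sum_image hinjg.injOn, Finset.mul_sum]
      refine Finset.sum_congr (Finset.filter_congr fun y _ => ?_) fun y _ => by
        rw [mul_smul_comm, hug]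
      rw [eq_comm]
      exact QuotientGroup.eq.trans (by rw [inv_mul_cancel_left])
    have hev : ∀ R : Finset G, ev (∑ y ∈ R, c (g * y) • (u y : B)) =
        ∑ y ∈ R, c (g * y) • (π y : D) := by
      intro R
      rw [map_sum]
      exact Finset.sum_congr rfl fun y _ => by rw [map_smul, hπ]
    have hmem : ∑ y ∈ T' with y ∈ fcCenter G, c (g * y) • (u y : B) ∈ fcSpan u :=
      Submodule.sum_mem _ fun y hy => Submodule.smul_mem _ _
        (Submodule.subset_span ⟨y, (Finset.mem_filter.mp hy).2, rfl⟩)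
    calc ‖p * ∑ x ∈ T with q x = q g, c x • (u x : B)‖
        = ‖(u g⁻¹ : B) * (p * ∑ x ∈ T with q x = q g, c x • (u x : B))‖ :=
          (CStarRing.norm_coe_unitary_mul _ _).symm
      _ = ‖p * ∑ y ∈ T' with y ∈ fcCenter G, c (g * y) • (u y : B)‖ := by
          rw [← mul_assoc, ← (hp g⁻¹).eq, mul_assoc, hsum2]
      _ ≤ C * ‖ev (∑ y ∈ T' with y ∈ fcCenter G, c (g * y) • (u y : B))‖ := hbound _ hmem
      _ ≤ C * ‖ev (∑ y ∈ T', c (g * y) • (u y : B))‖ := by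
          rw [hev, hev]
          gcongr
          exact norm_sum_filter_fcCenter_le hinj hscalar T' fun y => c (g * y)
      _ = C * ‖ev a‖ := by
          rw [← hsum, map_mul, ← hπ, CStarRing.norm_coe_unitary_mul]
  calc ‖p * a‖ = ‖∑ κ ∈ T.image q, p * ∑ x ∈ T with q x = κ, c x • (u x : B)‖ := by
        rw [← Finset.mul_sum, Finset.sum_fiberwise_of_maps_to fun x hx =>
          Finset.mem_image_of_mem q hx]
    _ ≤ ∑ κ ∈ T.image q, C * ‖ev a‖ := norm_sum_le_of_le _ hpart
    _ = (T.image q).card * (C * ‖ev a‖) := by rw [Finset.sum_const, nsmul_eq_mul]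
    _ ≤ T.card * (C * ‖ev a‖) := by
        gcongr
        exact Finset.card_image_le

/-- Polynomial growth upgrades the linear bound of `norm_mul_le_card_mul` to a contraction. -/
lemma norm_mul_le_of_bound {D : Type*} [CStarAlgebra D] (ev : B →⋆ₐ[ℂ] D) {π : G →* unitary D}
    (hπ : ∀ g, (π g : D) = ev (u g)) (hinj : Function.Injective π)
    (hscalar : ∀ z ∈ Subgroup.center G, ∃ c : ℂ, (π z : D) = c • 1) {p : B}
    (hproj : IsStarProjection p) (hp : ∀ g, Commute p (u g : B)) {C : ℝ} (hC : 0 ≤ C)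
    (hbound : ∀ b ∈ fcSpan u, ‖p * b‖ ≤ C * ‖ev b‖) {a : B}
    (ha : a ∈ Submodule.span ℂ (Set.range fun g => (u g : B))) : ‖p * a‖ ≤ ‖ev a‖ := by
  classical
  have hcomm : ∀ b ∈ Submodule.span ℂ (Set.range fun g => (u g : B)), Commute p b := by
    intro b hb
    induction hb using Submodule.span_induction with
    | mem x hx => obtain ⟨g, rfl⟩ := hx; exact hp g
    | zero => exact Commute.zero_right p
    | add x y _ _ hx hy => exact hx.add_right hy
    | smul c x _ hx => exact hx.smul_right c
  have hstar : star a ∈ Submodule.span ℂ (Set.range fun g => (u g : B)) := by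
    induction ha using Submodule.span_induction with
    | mem x hx =>
      obtain ⟨g, rfl⟩ := hx
      exact Submodule.subset_span ⟨g⁻¹, congrArg Subtype.val (map_inv u g)⟩
    | zero => simp
    | add x y _ _ hx hy => rw [star_add]; exact add_mem hx hy
    | smul c x _ hx => rw [star_smul]; exact Submodule.smul_mem _ _ hx
  -- Self-adjointness of `p * h` makes the norm of its `2^k`-th power exactly the `2^k`-th power of
  -- its norm.
  set h := star a * a with hdef
  have hmem : h ∈ Submodule.span ℂ (Set.range fun g => (u g : B)) := by
    have := Submodule.mul_mem_mul hstar ha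
    rw [Submodule.span_mul_span] at this
    refine Submodule.span_mono ?_ this
    rintro _ ⟨_, ⟨x, rfl⟩, _, ⟨y, rfl⟩, rfl⟩
    exact ⟨x * y, by simp⟩
  obtain ⟨S, hS⟩ : ∃ S : Finset G,
      h ∈ Submodule.span ℂ ((fun g => (u g : B)) '' (S : Set G)) := by
    rw [← Set.image_univ, Submodule.mem_span_image_iff_exists_fun] at hmem
    obtain ⟨S, -, c, hc⟩ := hmem
    exact ⟨S, Submodule.mem_span_image_finset_iff_exists_fun ℂ |>.mpr ⟨c, hc⟩⟩
  obtain ⟨C', d, hgrowth⟩ := exists_polynomial_growth S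
  have hsa : IsSelfAdjoint (p * h) := by
    have h1 : IsSelfAdjoint h := IsSelfAdjoint.star_mul_self a
    rw [IsSelfAdjoint, star_mul, h1.star_eq, hproj.isSelfAdjoint.star_eq, (hcomm h hmem).eq]
  have hpow : ∀ n : ℕ, n ≠ 0 → (p * h) ^ n = p * h ^ n := by
    intro n hn
    rw [(hcomm h hmem).mul_pow, hproj.isIdempotentElem.pow_eq hn]
  have hle : ‖p * h‖ ≤ ‖ev h‖ := by
    refine le_of_pow_le_polynomial_mul_pow (C := C' * C) (d := d) (norm_nonneg _) (by positivity)
      fun k => ?_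
    obtain ⟨T, hT, hmemT⟩ := hgrowth (2 ^ k)
    have hspan : h ^ 2 ^ k ∈ Submodule.span ℂ ((fun g => (u g : B)) '' (T : Set G)) := by
      refine Submodule.span_mono (Set.image_mono ?_) (pow_mem_span_of_lists hS (2 ^ k))
      rintro _ ⟨l, hl, hlS, rfl⟩
      exact hmemT l hl hlS
    obtain ⟨c, hc⟩ := (Submodule.mem_span_image_finset_iff_exists_fun' ℂ).mp hspan
    have h1 := norm_mul_le_card_mul ev hπ hinj hscalar hp hC hbound T c
    rw [hc] at h1
    rw [← hsa.norm_pow_two_pow, hpow _ (by positivity)]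
    have hTR : (T.card : ℝ) ≤ C' * (2 ^ k + 1) ^ d := by exact_mod_cast hT
    calc ‖p * h ^ 2 ^ k‖ ≤ T.card * (C * ‖ev (h ^ 2 ^ k)‖) := h1
      _ ≤ (C' * (2 ^ k + 1) ^ d) * (C * ‖ev h‖ ^ 2 ^ k) := by
          gcongr
          rw [map_pow]
          exact norm_pow_le' _ (by positivity)
      _ = _ := by ring
  have e1 : ‖p * h‖ = ‖p * a‖ ^ 2 := by
    rw [sq, ← CStarRing.norm_star_mul_self, star_mul, hproj.isSelfAdjoint.star_eq, mul_assoc,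
      ← mul_assoc p p, hproj.isIdempotentElem.eq, ← mul_assoc, (hcomm _ hstar).eq, mul_assoc]
  have e2 : ‖ev h‖ = ‖ev a‖ ^ 2 := by
    rw [sq, ← CStarRing.norm_star_mul_self, hdef, map_mul, map_star]
  rw [e1, e2] at hle
  exact (pow_le_pow_iff_left₀ (norm_nonneg _) (norm_nonneg _) two_ne_zero).mp hle

/-- Let `π = ev ∘ u` be faithful and scalar on the centre, and let `u` be scalar on a finite index
subgroup of the centre. Then the kernel of `ev` on the closed span of `u(G)` is cut out by a central
projection. -/
theorem exists_projection_norm_mul_le {D : Type*} [CStarAlgebra D] (ev : B →⋆ₐ[ℂ] D)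
    {π : G →* unitary D} (hπ : ∀ g, (π g : D) = ev (u g)) (hinj : Function.Injective π)
    (hscalar : ∀ z ∈ Subgroup.center G, ∃ c : ℂ, (π z : D) = c • 1)
    {N : Subgroup G} (hN : N ≤ Subgroup.center G)
    (hfin : N.IsFiniteRelIndex (Subgroup.center G))
    (huN : ∀ n ∈ N, ∃ c : ℂ, (u n : B) = c • 1) :
    ∃ p ∈ Submodule.span ℂ (Set.range fun g => (u g : B)), IsStarProjection p ∧
      (∀ g, Commute p (u g : B)) ∧ ev p = 1 ∧
      ∀ a ∈ Submodule.span ℂ (Set.range fun g => (u g : B)), ‖p * a‖ ≤ ‖ev a‖ := by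
  have hfd := finiteDimensional_fcSpan hN hfin huN
  -- The part of the kernel of `ev` visible on the FC-centre. The projection sought is the
  -- complement of its unit.
  let J : NonUnitalStarSubalgebra ℂ B :=
    { fcSpan u ⊓ LinearMap.ker ev.toAlgHom.toLinearMap with
      mul_mem' := by
        rintro a b ⟨ha, ha0⟩ ⟨hb, -⟩
        refine ⟨?_, ?_⟩
        · have h := Submodule.mul_mem_mul ha hb
          rw [fcSpan, Submodule.span_mul_span] at h
          refine Submodule.span_mono ?_ h
          rintro _ ⟨_, ⟨x, hx, rfl⟩, _, ⟨y, hy, rfl⟩, rfl⟩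
          exact ⟨x * y, mul_mem hx hy, by simp⟩
        · have h0 : ev a = 0 := ha0
          change ev (a * b) = 0
          rw [map_mul, h0, zero_mul]
      star_mem' := by
        rintro a ⟨ha, ha0⟩
        refine ⟨?_, ?_⟩
        · clear ha0
          change a ∈ fcSpan u at ha
          change star a ∈ fcSpan u
          induction ha using Submodule.span_induction with
          | mem x hx =>
            obtain ⟨g, hg, rfl⟩ := hx
            exact Submodule.subset_span ⟨g⁻¹, inv_mem hg, congrArg Subtype.val (map_inv u g)⟩
          | zero => simp
          | add x y _ _ hx hy => rw [star_add]; exact add_mem hx hy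
          | smul c x _ hx => rw [star_smul]; exact Submodule.smul_mem _ _ hx
        · have h0 : ev a = 0 := ha0
          change ev (star a) = 0
          rw [map_star, h0, star_zero] }
  have hJ : ∀ x, x ∈ J ↔ x ∈ fcSpan u ∧ ev x = 0 := fun x => Iff.rfl
  have : FiniteDimensional ℂ J :=
    Submodule.finiteDimensional_of_le (S₁ := J.toSubmodule) (S₂ := fcSpan u) fun x hx => hx.1
  obtain ⟨q, hqJ, hq, hunit⟩ := J.exists_unit_of_finiteDimensional
  have hle : fcSpan u ≤ Submodule.span ℂ (Set.range fun g => (u g : B)) :=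
    Submodule.span_mono (Set.image_subset_range _ _)
  have hcancel : ∀ g, (u g⁻¹ : B) * (u g : B) = 1 := fun g => by
    rw [← Submonoid.coe_mul, ← map_mul, inv_mul_cancel, map_one]; rfl
  have hcancel' : ∀ g, (u g : B) * (u g⁻¹ : B) = 1 := fun g => by simpa using hcancel g⁻¹
  have hconjJ : ∀ g, ∀ x ∈ J, (u g : B) * x * (u g⁻¹ : B) ∈ J := by
    intro g x hx
    refine ⟨?_, ?_⟩
    · have hx1 := hx.1
      clear hx
      change x ∈ fcSpan u at hx1
      change _ ∈ fcSpan u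
      induction hx1 using Submodule.span_induction with
      | mem x hx =>
        obtain ⟨f, hf, rfl⟩ := hx
        exact Submodule.subset_span ⟨g * f * g⁻¹, Subgroup.Normal.conj_mem inferInstance f hf g,
          by simp⟩
      | zero => simp
      | add x y _ _ hx hy => rw [mul_add, add_mul]; exact add_mem hx hy
      | smul c x _ hx => rw [mul_smul_comm, smul_mul_assoc]; exact Submodule.smul_mem _ _ hx
    · have h0 : ev x = 0 := hx.2
      change ev _ = 0
      rw [map_mul, map_mul, h0, mul_zero, zero_mul]
  -- Conjugation by `u g` preserves `J`, so it fixes the unit: `q' = q' q = q`.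
  have hqcomm : ∀ g, Commute q (u g : B) := by
    intro g
    set q' := (u g : B) * q * (u g⁻¹ : B) with hq'
    have hq'J : q' ∈ J := hconjJ g q hqJ
    have h1 : q' * q = q' := (hunit q' hq'J).2
    have h2 : q' * q = q := by
      have hx := (hunit _ (hconjJ g⁻¹ q hqJ)).1
      rw [inv_inv] at hx
      calc q' * q = (u g : B) * (q * ((u g⁻¹ : B) * q * (u g : B))) * (u g⁻¹ : B) := by
            simp only [hq', mul_assoc, hcancel', mul_one]
        _ = q := by
            rw [hx, mul_assoc, mul_assoc, mul_assoc, hcancel', mul_one, ← mul_assoc, hcancel',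
              one_mul]
    have h3 : q' = q := h1.symm.trans h2
    change q * (u g : B) = (u g : B) * q
    calc q * (u g : B) = q' * (u g : B) := by rw [h3]
      _ = (u g : B) * q := by rw [hq', mul_assoc, hcancel, mul_one]
  have hevq : ev q = 0 := hqJ.2
  let S : fcSpan u →ₗ[ℂ] B := LinearMap.mulLeft ℂ (1 - q) ∘ₗ (fcSpan u).subtype
  let T : fcSpan u →ₗ[ℂ] D := ev.toAlgHom.toLinearMap ∘ₗ (fcSpan u).subtype
  -- The kernel of `T` is `J`, which `1 - q` annihilates.
  obtain ⟨C, hC, hbound⟩ := LinearMap.exists_norm_le_of_ker_le S T fun b hb => by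
    have hbJ : (b : B) ∈ J := ⟨b.2, hb⟩
    change (1 - q) * (b : B) = 0
    rw [sub_mul, one_mul, (hunit _ hbJ).1, sub_self]
  have hpcomm : ∀ g, Commute (1 - q) (u g : B) := fun g => (Commute.one_left _).sub_left (hqcomm g)
  refine ⟨1 - q, sub_mem (Submodule.subset_span ⟨1, by simp⟩) (hle hqJ.1), hq.one_sub, hpcomm,
    by rw [map_sub, map_one, hevq, sub_zero], fun a ha => ?_⟩
  exact norm_mul_le_of_bound ev hπ hinj hscalar hq.one_sub hpcomm hC
    (fun b hb => hbound ⟨b, hb⟩) ha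

end FiniteIndex

/-! ### Schur's lemma and separability. -/

section Irreducible

/-- Distinct orthonormal vectors are `√2` apart, so balls of radius `1/2` around them are disjoint.
-/
lemma Orthonormal.countable_of_separableSpace {H : Type*} [NormedAddCommGroup H]
    [InnerProductSpace ℂ H] [TopologicalSpace.SeparableSpace H] {w : Set H}
    (hw : Orthonormal ℂ ((↑) : w → H)) : w.Countable := by
  refine Set.PairwiseDisjoint.countable_of_isOpen (s := fun x : H => Metric.ball x (1 / 2)) ?_
    (fun _ _ => Metric.isOpen_ball) fun x _ => ⟨x, Metric.mem_ball_self (by norm_num)⟩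
  intro x hx y hy hxy
  refine Metric.ball_disjoint_ball ?_
  have h0 : inner ℂ x y = 0 := hw.2 (i := ⟨x, hx⟩) (j := ⟨y, hy⟩) fun h => hxy (congrArg Subtype.val h)
  have hx1 : ‖x‖ = 1 := hw.1 ⟨x, hx⟩
  have hy1 : ‖y‖ = 1 := hw.1 ⟨y, hy⟩
  have h := norm_sub_sq (𝕜 := ℂ) x y
  rw [h0, hx1, hy1] at h
  rw [dist_eq_norm]
  have h2 : ‖x - y‖ ^ 2 = 2 := by rw [h]; norm_num
  nlinarith [norm_nonneg (x - y)]

variable {G : Type u} [Group G] {H : Type v} [NormedAddCommGroup H] [InnerProductSpace ℂ H]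
  [CompleteSpace H] {π : G →* unitary (H →L[ℂ] H)}

/-- `ker S` is a closed invariant subspace containing the range of `T`. -/
lemma IsIrreducibleRep.eq_zero_or_eq_zero (hirr : IsIrreducibleRep π) {S T : H →L[ℂ] H}
    (hS : ∀ g, Commute S (π g : H →L[ℂ] H)) (hST : S * T = 0) : S = 0 ∨ T = 0 := by
  have hinv : ∀ g : G, ∀ ξ ∈ S.ker, (π g : H →L[ℂ] H) ξ ∈ S.ker := by
    intro g ξ hξ
    have h1 : S ((π g : H →L[ℂ] H) ξ) = (π g : H →L[ℂ] H) (S ξ) :=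
      congrArg (fun R : H →L[ℂ] H => R ξ) (hS g).eq
    have h2 : S ξ = 0 := hξ
    change S ((π g : H →L[ℂ] H) ξ) = 0
    rw [h1, h2, map_zero]
  rcases hirr.2 S.ker S.isClosed_ker hinv with h | h
  · right
    ext ξ
    have : T ξ ∈ S.ker := congrArg (fun R : H →L[ℂ] H => R ξ) hST
    rw [h] at this
    exact this
  · left
    ext ξ
    have : ξ ∈ S.ker := by rw [h]; trivial
    exact this

/-- Schur's lemma: a normal operator which, together with its adjoint, commutes with an irreducible
representation is scalar. -/
theorem IsIrreducibleRep.exists_eq_smul_one (hirr : IsIrreducibleRep π) {T : H →L[ℂ] H}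
    [hT : IsStarNormal T] (h1 : ∀ g, Commute T (π g : H →L[ℂ] H))
    (h2 : ∀ g, Commute (star T) (π g : H →L[ℂ] H)) : ∃ c : ℂ, T = c • 1 := by
  have := hirr.1
  obtain ⟨l, hl⟩ := spectrum.nonempty T
  refine ⟨l, ?_⟩
  have hsub : ∀ m ∈ spectrum ℂ T, m = l := by
    intro m hm
    by_contra hne
    have hr : 0 < ‖m - l‖ / 2 := half_pos (norm_pos_iff.mpr (sub_ne_zero.mpr hne))
    set r := ‖m - l‖ / 2 with hrdef
    -- Bumps of radius half the distance between two spectral points have product zero, yet neither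
    -- vanishes on the spectrum; this contradicts the absence of zero divisors in the commutant.
    let bump : ℂ → ℂ → ℂ := fun a x => ((max 0 (r - ‖x - a‖) : ℝ) : ℂ)
    have hcont : ∀ a, Continuous (bump a) := fun a => by fun_prop
    have hself : ∀ a, bump a a ≠ 0 := fun a => by
      simp only [bump, sub_self, norm_zero, sub_zero, max_eq_right hr.le]
      exact_mod_cast hr.ne'
    have hzero : ∀ x, bump l x * bump m x = 0 := by
      intro x
      have htri : ‖m - l‖ ≤ ‖x - l‖ + ‖x - m‖ := by
        rw [show m - l = (x - l) - (x - m) by ring]; exact norm_sub_le _ _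
      rcases le_or_gt r ‖x - l‖ with h | h
      · simp [bump, max_eq_left (sub_nonpos.mpr h)]
      · have : r ≤ ‖x - m‖ := by linarith
        simp [bump, max_eq_left (sub_nonpos.mpr this)]
    have hmul : cfc (bump l) T * cfc (bump m) T = 0 := by
      rw [← cfc_mul _ _ T (hcont l).continuousOn (hcont m).continuousOn]
      simp only [hzero]
      exact cfc_const_zero ℂ T
    have hne0 : ∀ a ∈ spectrum ℂ T, cfc (bump a) T ≠ 0 := by
      intro a ha h0
      have hmap := cfc_map_spectrum (bump a) T hT (hcont a).continuousOn
      rw [h0, spectrum.zero_eq] at hmap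
      have : bump a a ∈ ({0} : Set ℂ) := by rw [hmap]; exact ⟨a, ha, rfl⟩
      exact hself a this
    rcases hirr.eq_zero_or_eq_zero (fun g => (h1 g).cfc (h2 g) (bump l)) hmul with h | h
    · exact hne0 l hl h
    · exact hne0 m hm h
  calc T = cfc (id : ℂ → ℂ) T := (cfc_id ℂ T).symm
    _ = cfc (fun _ => l) T := cfc_congr hsub
    _ = l • 1 := by rw [cfc_const l T, Algebra.algebraMap_eq_smul_one]

lemma IsIrreducibleRep.exists_eq_smul_one_of_mem_center (hirr : IsIrreducibleRep π) {z : G}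
    (hz : z ∈ Subgroup.center G) : ∃ c : ℂ, (π z : H →L[ℂ] H) = c • 1 := by
  have hcomm : ∀ w ∈ Subgroup.center G, ∀ g, Commute (π w : H →L[ℂ] H) (π g : H →L[ℂ] H) := by
    intro w hw g
    have h := congrArg (fun x => (π x : H →L[ℂ] H)) (Subgroup.mem_center_iff.mp hw g)
    simp only [map_mul, Submonoid.coe_mul] at h
    exact h.symm
  have : IsStarNormal (π z : H →L[ℂ] H) := inferInstance
  refine hirr.exists_eq_smul_one (hcomm z hz) fun g => ?_
  have h := hcomm z⁻¹ (inv_mem hz) g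
  rw [map_inv] at h
  exact h

/-- The space of an irreducible representation of a countable group is separable. -/
lemma IsIrreducibleRep.separableSpace [Countable G] (hirr : IsIrreducibleRep π) :
    TopologicalSpace.SeparableSpace H := by
  have := hirr.1
  obtain ⟨ξ, hξ⟩ := exists_ne (0 : H)
  let O : Set H := Set.range fun g => (π g : H →L[ℂ] H) ξ
  let K := (Submodule.span ℂ O).topologicalClosure
  have hinv : ∀ g : G, ∀ η ∈ K, (π g : H →L[ℂ] H) η ∈ K := by
    intro g η hη
    have hmaps : Set.MapsTo (π g : H →L[ℂ] H) (Submodule.span ℂ O) (Submodule.span ℂ O) := by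
      intro η hη
      change _ ∈ Submodule.span ℂ O
      induction hη using Submodule.span_induction with
      | mem x hx =>
        obtain ⟨h, rfl⟩ := hx
        exact Submodule.subset_span ⟨g * h, by simp⟩
      | zero => simp
      | add x y _ _ hx hy => rw [map_add]; exact add_mem hx hy
      | smul c x _ hx => rw [map_smul]; exact Submodule.smul_mem _ _ hx
    exact hmaps.closure (π g : H →L[ℂ] H).continuous hη
  have htop : K = ⊤ := by
    refine (hirr.2 K (Submodule.isClosed_topologicalClosure _) hinv).resolve_left fun h => hξ ?_
    have : ξ ∈ K := Submodule.le_topologicalClosure _ (Submodule.subset_span ⟨1, by simp⟩)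
    rw [h] at this
    exact this
  have hsep : TopologicalSpace.IsSeparable (K : Set H) :=
    ((Set.countable_range _).isSeparable.span (R := ℂ)).closure
  rw [htop, Submodule.top_coe] at hsep
  exact TopologicalSpace.isSeparable_univ_iff.mp hsep

variable (H) in
/-- A separable Hilbert space is isomorphic to one in any given universe. -/
lemma exists_linearIsometryEquiv_of_separableSpace [TopologicalSpace.SeparableSpace H] :
    ∃ ι : Type u, Nonempty (H ≃ₗᵢ[ℂ] lp (fun _ : ι => ℂ) 2) := by
  obtain ⟨w, b, hb⟩ := exists_hilbertBasis ℂ H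
  have hw : Orthonormal ℂ ((↑) : w → H) := hb ▸ b.orthonormal
  have hc : Countable w := (Orthonormal.countable_of_separableSpace hw).to_subtype
  -- A countable index set has a copy in every universe.
  let e := equivShrink.{u} w
  have hv : Orthonormal ℂ (((↑) : w → H) ∘ e.symm) := hw.comp _ e.symm.injective
  refine ⟨Shrink.{u} w, ⟨(HilbertBasis.mk hv ?_).repr⟩⟩
  rw [e.symm.surjective.range_comp, ← hb, b.dense_span]

end Irreducible

lemma Group.countable_of_fg (G : Type*) [Group G] [Group.FG G] : Countable G := by
  obtain ⟨S, _, f, hf⟩ :=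
    Group.fg_iff_exists_freeGroup_hom_surjective_finite.mp (inferInstance : Group.FG G)
  exact hf.countable

/-! ### Cocycles of central extensions. -/

section CentralExtension

variable {G : Type u} [Group G] (N : Subgroup G) [N.Normal]

open Classical in
/-- A section of the quotient map `G → G ⧸ N` preserving the identity. -/
noncomputable def normalizedSection (x : G ⧸ N) : G := if x = 1 then 1 else x.out

@[simp] lemma normalizedSection_one : normalizedSection N 1 = 1 := if_pos rfl

@[simp] lemma mk_normalizedSection (x : G ⧸ N) : ((normalizedSection N x : G) : G ⧸ N) = x := by
  unfold normalizedSection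
  split_ifs with h
  · rw [h]; rfl
  · exact QuotientGroup.out_eq' x

/-- The `N`-valued cocycle of the extension `N → G → G ⧸ N`. -/
noncomputable def extensionCocycle (x y : G ⧸ N) : N :=
  ⟨normalizedSection N x * normalizedSection N y * (normalizedSection N (x * y))⁻¹, by
    rw [← QuotientGroup.eq_one_iff]; simp⟩

/-- The `N`-component of `g` with respect to the normalized section. -/
noncomputable def sectionDefect (g : G) : N :=
  ⟨g * (normalizedSection N (g : G ⧸ N))⁻¹, by rw [← QuotientGroup.eq_one_iff]; simp⟩

variable {N}

lemma normalizedSection_mul (x y : G ⧸ N) :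
    normalizedSection N x * normalizedSection N y =
      extensionCocycle N x y * normalizedSection N (x * y) := by
  simp [extensionCocycle]

lemma sectionDefect_mul_normalizedSection (g : G) :
    (sectionDefect N g : G) * normalizedSection N (g : G ⧸ N) = g := by
  simp [sectionDefect]

/-- Both sides measure the defect of a product of three section values, bracketed in two ways;
centrality moves the inner defect past the first factor. -/
lemma extensionCocycle_mul (hN : N ≤ Subgroup.center G) (x y z : G ⧸ N) :
    extensionCocycle N x y * extensionCocycle N (x * y) z =
      extensionCocycle N x (y * z) * extensionCocycle N y z := by
  refine Subtype.ext (mul_right_cancel (b := normalizedSection N (x * y * z)) ?_)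
  have hc : ∀ (n : N) (g : G), (n : G) * g = g * n := fun n g =>
    (Subgroup.mem_center_iff.mp (hN n.2) g).symm
  calc ((extensionCocycle N x y : G) * extensionCocycle N (x * y) z) * normalizedSection N (x * y * z)
      = normalizedSection N x * normalizedSection N y * normalizedSection N z := by
        rw [mul_assoc, ← normalizedSection_mul, ← mul_assoc, ← normalizedSection_mul]
    _ = normalizedSection N x * (extensionCocycle N y z * normalizedSection N (y * z)) := by
        rw [mul_assoc, normalizedSection_mul]
    _ = (extensionCocycle N x (y * z) : G) * extensionCocycle N y z *
          normalizedSection N (x * y * z) := by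
        rw [← mul_assoc, ← hc, mul_assoc, normalizedSection_mul, mul_assoc x y z, ← mul_assoc, hc]

/-- The identity that makes `g ↦ χ(defect of g) V_{gN}` multiplicative, the cocycle absorbing the
twist. -/
lemma sectionDefect_mul (hN : N ≤ Subgroup.center G) (g h : G) :
    sectionDefect N (g * h) = sectionDefect N g * sectionDefect N h *
      extensionCocycle N (g : G ⧸ N) (h : G ⧸ N) := by
  refine Subtype.ext (mul_right_cancel (b := normalizedSection N ((g * h : G) : G ⧸ N)) ?_)
  have hc : ∀ (n : N) (g : G), (n : G) * g = g * n := fun n g =>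
    (Subgroup.mem_center_iff.mp (hN n.2) g).symm
  rw [sectionDefect_mul_normalizedSection]
  calc g * h = (sectionDefect N g * normalizedSection N (g : G ⧸ N)) *
        (sectionDefect N h * normalizedSection N (h : G ⧸ N)) := by
        rw [sectionDefect_mul_normalizedSection, sectionDefect_mul_normalizedSection]
    _ = sectionDefect N g * sectionDefect N h *
        (normalizedSection N (g : G ⧸ N) * normalizedSection N (h : G ⧸ N)) := by
        rw [mul_assoc, ← mul_assoc (normalizedSection N _) (sectionDefect N h : G), ← hc]
        simp only [mul_assoc]
    _ = _ := by
        rw [normalizedSection_mul, ← mul_assoc]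
        rfl

lemma sectionDefect_of_mem {n : G} (hn : n ∈ N) : sectionDefect N n = ⟨n, hn⟩ := by
  have : (n : G ⧸ N) = 1 := (QuotientGroup.eq_one_iff n).mpr hn
  simp [sectionDefect, this]

/-- The circle-valued cocycle obtained from a character of a central subgroup. -/
noncomputable def characterCocycle (hN : N ≤ Subgroup.center G) (χ : N →* Circle) :
    TwoCocycle (G ⧸ N) where
  toFun x y := χ (extensionCocycle N x y)
  cocycle' x y z := by rw [← map_mul, ← map_mul, extensionCocycle_mul hN]
  one_left' x := by
    have : extensionCocycle N 1 x = 1 := Subtype.ext (by simp [extensionCocycle])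
    rw [this, map_one]
  one_right' x := by
    have : extensionCocycle N x 1 = 1 := Subtype.ext (by simp [extensionCocycle])
    rw [this, map_one]

open scoped IsMulCommutative in
/-- The cocycle of a character of a finitely generated torsion-free central subgroup is homotopic
to the trivial one. -/
theorem characterCocycle_homotopic_trivial (hN : N ≤ Subgroup.center G) [Group.FG N]
    [IsMulTorsionFree N] (χ : N →* Circle) :
    (characterCocycle hN χ).Homotopic (TwoCocycle.trivial (G ⧸ N)) := by
  have : IsMulCommutative N :=
    ⟨⟨fun a b => Subtype.ext (Subgroup.mem_center_iff.mp (hN b.2) a)⟩⟩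
  obtain ⟨φ, hφ⟩ := exists_circleExp_lift χ
  -- Scaling the real lift of `χ` linearly to zero gives a path of characters, hence of cocycles.
  let ψ : ℝ → N →* Circle := fun t =>
    { toFun n := Circle.exp ((1 - t) * φ (Additive.ofMul n))
      map_one' := by simp
      map_mul' a b := by rw [ofMul_mul, map_add, mul_add, Circle.exp_add] }
  refine ⟨fun t => characterCocycle hN (ψ t), fun x y => ?_, ?_, ?_⟩
  · change Continuous fun t : unitInterval =>
      Circle.exp ((1 - (t : ℝ)) * φ (Additive.ofMul (extensionCocycle N x y)))
    fun_prop
  · ext x y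
    change ((Circle.exp ((1 - ((0 : unitInterval) : ℝ)) * _) : Circle) : ℂ) = χ _
    rw [Set.Icc.coe_zero, sub_zero, one_mul, hφ]
  · ext x y
    change ((Circle.exp ((1 - ((1 : unitInterval) : ℝ)) * _) : Circle) : ℂ) = 1
    simp

end CentralExtension

/-! ### Generators of the twisted group C*-algebra. -/

section TwistedUnitaries

variable {Γ : Type u} [Group Γ] (σ : TwoCocycle Γ)

lemma star_universalTwisted_mul_self (x : Γ) :
    star (universalTwisted σ x) * universalTwisted σ x = 1 := by
  ext1
  funext ρ
  exact Unitary.star_mul_self_of_mem (ρ.V x).2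

lemma universalTwisted_mul_star_self (x : Γ) :
    universalTwisted σ x * star (universalTwisted σ x) = 1 := by
  ext1
  funext ρ
  exact Unitary.mul_star_self_of_mem (ρ.V x).2

lemma universalTwisted_mul (x y : Γ) :
    universalTwisted σ x * universalTwisted σ y =
      (σ x y : ℂ) • universalTwisted σ (x * y) := by
  ext1
  funext ρ
  exact ρ.map_mul' x y

/-- The canonical unitaries of `C*(Γ, σ)`. -/
noncomputable def twistedUnitary (x : Γ) : unitary (TwistedGroupCStar σ) :=
  ⟨⟨universalTwisted σ x, StarSubalgebra.le_topologicalClosure _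
    (StarAlgebra.subset_adjoin ℂ _ ⟨x, rfl⟩)⟩,
    Unitary.mem_iff.mpr ⟨Subtype.ext (star_universalTwisted_mul_self σ x),
      Subtype.ext (universalTwisted_mul_star_self σ x)⟩⟩

lemma twistedUnitary_mul (x y : Γ) :
    (twistedUnitary σ x : TwistedGroupCStar σ) * (twistedUnitary σ y : TwistedGroupCStar σ) =
      (σ x y : ℂ) • (twistedUnitary σ (x * y) : TwistedGroupCStar σ) :=
  Subtype.ext (universalTwisted_mul σ x y)

lemma twistedUnitary_one : (twistedUnitary σ 1 : TwistedGroupCStar σ) = 1 := by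
  have h := twistedUnitary_mul σ 1 1
  have h1 : ((σ 1 1 : Circle) : ℂ) = 1 := by rw [σ.one_left' 1]; rfl
  rw [mul_one, h1, one_smul] at h
  calc (twistedUnitary σ 1 : TwistedGroupCStar σ)
      = star (twistedUnitary σ 1 : TwistedGroupCStar σ) *
          ((twistedUnitary σ 1 : TwistedGroupCStar σ) * twistedUnitary σ 1) := by
        rw [← mul_assoc, Unitary.star_mul_self_of_mem (twistedUnitary σ 1).2, one_mul]
    _ = 1 := by rw [h, Unitary.star_mul_self_of_mem (twistedUnitary σ 1).2]

variable {σ} in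
/-- The representation of `C*(Γ, σ)` given by a `σ`-representation. -/
noncomputable def TwistedRep.lift (ρ : TwistedRep σ) :
    TwistedGroupCStar σ →⋆ₐ[ℂ] (ρ.space →L[ℂ] ρ.space) where
  toFun a := (a.1 : ∀ ρ : TwistedRep σ, ρ.space →L[ℂ] ρ.space) ρ
  map_one' := rfl
  map_mul' _ _ := rfl
  map_zero' := rfl
  map_add' _ _ := rfl
  commutes' _ := rfl
  map_star' _ := rfl

lemma TwistedRep.lift_twistedUnitary {σ : TwoCocycle Γ} (ρ : TwistedRep σ) (x : Γ) :
    ρ.lift (twistedUnitary σ x : TwistedGroupCStar σ) = ρ.V x := rfl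

/-- The canonical unitaries span a dense subspace of `C*(Γ, σ)`. -/
lemma dense_span_twistedUnitary :
    Dense (Submodule.span ℂ (Set.range fun x => (twistedUnitary σ x : TwistedGroupCStar σ)) :
      Set (TwistedGroupCStar σ)) := by
  let S := Submodule.span ℂ (Set.range fun x => (twistedUnitary σ x : TwistedGroupCStar σ))
  have hmul : ∀ a ∈ S, ∀ b ∈ S, a * b ∈ S := by
    intro a ha b hb
    have h := Submodule.mul_mem_mul ha hb
    rw [Submodule.span_mul_span] at h
    refine Submodule.span_le.mpr ?_ h
    rintro _ ⟨_, ⟨x, rfl⟩, _, ⟨y, rfl⟩, rfl⟩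
    change (twistedUnitary σ x : TwistedGroupCStar σ) * twistedUnitary σ y ∈ S
    rw [twistedUnitary_mul]
    exact Submodule.smul_mem _ _ (Submodule.subset_span ⟨_, rfl⟩)
  have hone : (1 : TwistedGroupCStar σ) ∈ S :=
    Submodule.subset_span ⟨1, twistedUnitary_one σ⟩
  have hstar : ∀ a ∈ S, star a ∈ S := by
    intro a ha
    induction ha using Submodule.span_induction with
    | mem _ hx =>
      obtain ⟨x, rfl⟩ := hx
      have h := twistedUnitary_mul σ x⁻¹ x
      rw [inv_mul_cancel, twistedUnitary_one] at h
      -- Up to a scalar of modulus one, the adjoint of `V_x` is `V_{x⁻¹}`, so the linear span is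
      -- already a *-algebra.
      have h2 : star (twistedUnitary σ x : TwistedGroupCStar σ) =
          (σ x⁻¹ x : ℂ)⁻¹ • (twistedUnitary σ x⁻¹ : TwistedGroupCStar σ) := by
        rw [eq_inv_smul_iff₀ (Circle.coe_ne_zero _), ← smul_one_mul, ← h, mul_assoc,
          Unitary.mul_star_self_of_mem (twistedUnitary σ x).2, mul_one]
      rw [h2]
      exact Submodule.smul_mem _ _ (Submodule.subset_span ⟨_, rfl⟩)
    | zero => simp
    | add x y _ _ hx hy => rw [star_add]; exact add_mem hx hy
    | smul c x _ hx => rw [star_smul]; exact Submodule.smul_mem _ _ hx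
  have hadjoin : ∀ b ∈ StarAlgebra.adjoin ℂ (Set.range (universalTwisted σ)),
      ∃ a ∈ S, a.1 = b := by
    intro b hb
    induction hb using StarAlgebra.adjoin_induction with
    | mem _ hx =>
      obtain ⟨x, rfl⟩ := hx
      exact ⟨_, Submodule.subset_span ⟨x, rfl⟩, rfl⟩
    | algebraMap c =>
      refine ⟨c • 1, Submodule.smul_mem _ _ hone, ?_⟩
      rw [Algebra.algebraMap_eq_smul_one]
      rfl
    | add x y _ _ hx hy =>
      obtain ⟨a, ha, rfl⟩ := hx
      obtain ⟨b, hb, rfl⟩ := hy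
      exact ⟨a + b, add_mem ha hb, rfl⟩
    | mul x y _ _ hx hy =>
      obtain ⟨a, ha, rfl⟩ := hx
      obtain ⟨b, hb, rfl⟩ := hy
      exact ⟨a * b, hmul a ha b hb, rfl⟩
    | star x _ hx =>
      obtain ⟨a, ha, rfl⟩ := hx
      exact ⟨star a, hstar a ha, rfl⟩
  have hind : Topology.IsInducing (fun a : TwistedGroupCStar σ => (a.1 : TwistedRepProduct σ)) :=
    Topology.IsInducing.subtypeVal
  intro a
  rw [hind.closure_eq_preimage_closure_image]
  have ha : a.1 ∈ closure (StarAlgebra.adjoin ℂ (Set.range (universalTwisted σ)) :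
      Set (TwistedRepProduct σ)) := a.2
  exact closure_mono (fun b hb => hadjoin b hb) ha

end TwistedUnitaries

/-! ### Identifying the cutdown with the generated algebra. -/

section Cutdown

variable {A : Type u} [CStarAlgebra A] {H : Type v} [NormedAddCommGroup H] [InnerProductSpace ℂ H]
  [CompleteSpace H] {G : Type*} [Group G]

lemma mem_centralCutdown {p : A} (hp : IsStarProjection p) (hc : p ∈ Set.center A) {a : A} :
    a ∈ centralCutdown p hp hc ↔ p * a = a := by
  refine ⟨?_, fun h => ⟨a, h⟩⟩
  rintro ⟨b, rfl⟩
  change p * (p * b) = p * b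
  rw [← mul_assoc, hp.isIdempotentElem.eq]

/-- If `E : A → B(H)` restricts to an isometry on `pA`, maps `p` to `1`, and maps a family of
unitaries with dense span to `π(G)`, then `pA` is isomorphic to `C*_π(G)`. -/
theorem nonempty_repCStarAlgebra_equiv_centralCutdown {π : G →* unitary (H →L[ℂ] H)} {p : A}
    (hp : IsStarProjection p) (hc : p ∈ Set.center A) (E : A →⋆ₐ[ℂ] (H →L[ℂ] H)) (hE : E p = 1)
    {u : G → A} (hu : ∀ g, E (u g) = π g)
    (hdense : Dense (Submodule.span ℂ (Set.range u) : Set A)) (hle : ∀ a, ‖p * a‖ ≤ ‖E a‖) :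
    Nonempty (repCStarAlgebra π ≃⋆ₐ[ℂ] centralCutdown p hp hc) := by
  have hcont : Continuous E :=
    AddMonoidHomClass.continuous_of_bound E 1 fun a => by
      rw [one_mul]; exact NonUnitalStarAlgHom.norm_apply_le E a
  have hEp : ∀ a, E (p * a) = E a := fun a => by rw [map_mul, hE, one_mul]
  have hmem : ∀ a, E a ∈ repCStarAlgebra π := by
    intro a
    refine closure_minimal (s := (Submodule.span ℂ (Set.range u) : Set A))
      (t := E ⁻¹' (repCStarAlgebra π : Set (H →L[ℂ] H))) ?_
      ((StarSubalgebra.isClosed_topologicalClosure _).preimage hcont) (hdense a)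
    intro b hb
    change E b ∈ repCStarAlgebra π
    induction hb using Submodule.span_induction with
    | mem _ hx =>
      obtain ⟨g, rfl⟩ := hx
      rw [hu]
      exact StarSubalgebra.le_topologicalClosure _ (StarAlgebra.subset_adjoin ℂ _ ⟨g, rfl⟩)
    | zero => rw [map_zero]; exact zero_mem _
    | add x y _ _ hx hy => rw [map_add]; exact add_mem hx hy
    | smul c x _ hx => rw [map_smul]; exact (repCStarAlgebra π).smul_mem hx c
  -- `E` and its restriction to the complete set `pA` have the same range, and the restriction is
  -- bounded below.
  have hclosed : IsClosed (Set.range E) := by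
    let C := {a : A | p * a = a}
    have hC : IsClosed C := isClosed_eq (continuous_const_mul p) continuous_id
    have := hC.completeSpace_coe
    have hanti : AntilipschitzWith 1 (fun a : C => E a) := by
      refine AntilipschitzWith.of_le_mul_dist fun a b => ?_
      rw [NNReal.coe_one, one_mul, Subtype.dist_eq, dist_eq_norm, dist_eq_norm, ← map_sub]
      refine le_trans (le_of_eq ?_) (hle _)
      rw [mul_sub, a.2, b.2]
    have huc : UniformContinuous (fun a : C => E a) :=
      (uniformContinuous_addMonoidHom_of_continuous hcont).comp uniformContinuous_subtype_val
    suffices hrange : Set.range E = Set.range (fun a : C => E a) by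
      rw [hrange]
      exact hanti.isClosed_range huc
    refine Set.Subset.antisymm ?_ ?_
    · rintro _ ⟨a, rfl⟩
      exact ⟨⟨p * a, by
        change p * (p * a) = p * a
        rw [← mul_assoc, hp.isIdempotentElem.eq]⟩, hEp a⟩
    · rintro _ ⟨a, rfl⟩
      exact ⟨a, rfl⟩
  have hsurj : ∀ T ∈ repCStarAlgebra π, ∃ a, E a = T := by
    intro T hT
    have hsub : (StarAlgebra.adjoin ℂ (Set.range fun g : G => (π g : H →L[ℂ] H))) ≤ E.range := by
      refine StarAlgebra.adjoin_le ?_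
      rintro _ ⟨g, rfl⟩
      exact ⟨u g, hu g⟩
    exact closure_minimal (fun x hx => hsub hx) hclosed hT
  let F : centralCutdown p hp hc →⋆ₙₐ[ℂ] repCStarAlgebra π :=
    { toFun a := ⟨E a, hmem a⟩
      map_smul' c a := Subtype.ext (map_smul E c (a : A))
      map_zero' := Subtype.ext (map_zero E)
      map_add' a b := Subtype.ext (map_add E (a : A) b)
      map_mul' a b := Subtype.ext (map_mul E (a : A) b)
      map_star' a := Subtype.ext (map_star E (a : A)) }
  have hF : Function.Bijective F := by
    constructor
    · refine (injective_iff_map_eq_zero F).mpr fun a ha => ?_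
      have h0 : E a = 0 := congrArg Subtype.val ha
      have h1 := hle a
      rw [h0, norm_zero, (mem_centralCutdown hp hc).mp a.2] at h1
      exact Subtype.ext (norm_le_zero_iff.mp h1)
    · rintro ⟨T, hT⟩
      obtain ⟨a, rfl⟩ := hsurj T hT
      exact ⟨⟨p * a, a, rfl⟩, Subtype.ext (hEp a)⟩
  exact ⟨(StarAlgEquiv.ofBijective F hF).symm⟩

end Cutdown

/-! ### Representations with prescribed central character as twisted representations. -/

section CentralCharacter

/-- A representation which is scalar on a subgroup restricts to a character there. -/
lemma exists_centralCharacter {G : Type u} [Group G] {N : Subgroup G} {H : Type v} [NormedAddCommGroup H] [InnerProductSpace ℂ H]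
    [CompleteSpace H] [Nontrivial H] (π : G →* unitary (H →L[ℂ] H))
    (hscalar : ∀ n ∈ N, ∃ c : ℂ, (π n : H →L[ℂ] H) = c • 1) :
    ∃ χ : N →* Circle, ∀ n : N, (π n : H →L[ℂ] H) = (χ n : ℂ) • 1 := by
  choose c hc using fun n : N => hscalar n n.2
  have hnorm : ∀ n, ‖c n‖ = 1 := by
    intro n
    have h := CStarRing.norm_coe_unitary (π n)
    rwa [hc, norm_smul, CStarRing.norm_one, mul_one] at h
  have hinj : Function.Injective fun z : ℂ => z • (1 : H →L[ℂ] H) :=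
    smul_left_injective ℂ one_ne_zero
  refine ⟨⟨⟨fun n => ⟨c n, mem_sphere_zero_iff_norm.mpr (hnorm n)⟩, ?_⟩, fun a b => ?_⟩, hc⟩
  · refine Subtype.ext (hinj ?_)
    change c 1 • (1 : H →L[ℂ] H) = (1 : ℂ) • 1
    rw [← hc]
    simp
  · refine Subtype.ext (hinj ?_)
    change c (a * b) • (1 : H →L[ℂ] H) = (c a * c b) • 1
    rw [← hc, mul_smul, ← hc b, ← smul_one_mul (c a), ← hc a]
    simp

variable {G : Type u} [Group G] {N : Subgroup G} [N.Normal]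

/-- The representation of `G` in `C*(G ⧸ N, σ)` extending the character `χ` of `N`. -/
noncomputable def centralUniversalRep (hN : N ≤ Subgroup.center G) (χ : N →* Circle) :
    G →* unitary (TwistedGroupCStar (characterCocycle hN χ)) where
  toFun g := ⟨(χ (sectionDefect N g) : ℂ) •
      (twistedUnitary (characterCocycle hN χ) (g : G ⧸ N) : TwistedGroupCStar (characterCocycle hN χ)), by
    have hc : starRingEnd ℂ (χ (sectionDefect N g) : ℂ) * (χ (sectionDefect N g) : ℂ) = 1 := by
      rw [← Circle.coe_inv_eq_conj, ← Circle.coe_mul, inv_mul_cancel, Circle.coe_one]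
    rw [Unitary.mem_iff]
    constructor
    · rw [star_smul, smul_mul_smul_comm, Unitary.star_mul_self_of_mem (twistedUnitary _ _).2]
      change (starRingEnd ℂ (χ (sectionDefect N g) : ℂ) * (χ (sectionDefect N g) : ℂ)) • _ = _
      rw [hc, one_smul]
    · rw [star_smul, smul_mul_smul_comm, Unitary.mul_star_self_of_mem (twistedUnitary _ _).2,
        mul_comm]
      change (starRingEnd ℂ (χ (sectionDefect N g) : ℂ) * (χ (sectionDefect N g) : ℂ)) • _ = _
      rw [hc, one_smul]⟩
  map_one' := by
    refine Subtype.ext ?_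
    change (χ (sectionDefect N 1) : ℂ) •
      (twistedUnitary (characterCocycle hN χ) 1 : TwistedGroupCStar (characterCocycle hN χ)) = 1
    rw [sectionDefect_of_mem N.one_mem, twistedUnitary_one, show (⟨1, N.one_mem⟩ : N) = 1 from rfl,
      map_one, Circle.coe_one, one_smul]
  map_mul' g h := by
    refine Subtype.ext ?_
    change (χ (sectionDefect N (g * h)) : ℂ) •
      (twistedUnitary (characterCocycle hN χ) ((g : G ⧸ N) * (h : G ⧸ N)) : TwistedGroupCStar (characterCocycle hN χ)) =
      ((χ (sectionDefect N g) : ℂ) • (twistedUnitary (characterCocycle hN χ) (g : G ⧸ N) : TwistedGroupCStar (characterCocycle hN χ))) *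
      ((χ (sectionDefect N h) : ℂ) • (twistedUnitary (characterCocycle hN χ) (h : G ⧸ N) : TwistedGroupCStar (characterCocycle hN χ)))
    rw [smul_mul_smul_comm, twistedUnitary_mul, smul_smul, sectionDefect_mul hN, map_mul, map_mul,
      Circle.coe_mul, Circle.coe_mul]
    rfl

lemma centralUniversalRep_apply (hN : N ≤ Subgroup.center G) (χ : N →* Circle) (g : G) :
    (centralUniversalRep hN χ g : TwistedGroupCStar (characterCocycle hN χ)) =
      (χ (sectionDefect N g) : ℂ) • (twistedUnitary (characterCocycle hN χ) (g : G ⧸ N) : TwistedGroupCStar (characterCocycle hN χ)) := rfl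

lemma centralUniversalRep_of_mem (hN : N ≤ Subgroup.center G) (χ : N →* Circle) {n : G}
    (hn : n ∈ N) : (centralUniversalRep hN χ n : TwistedGroupCStar (characterCocycle hN χ)) =
      (χ ⟨n, hn⟩ : ℂ) • 1 := by
  rw [centralUniversalRep_apply, sectionDefect_of_mem hn, (QuotientGroup.eq_one_iff n).mpr hn,
    twistedUnitary_one]

/-- Each canonical twisted unitary is a scalar multiple of a value of the representation. -/
lemma dense_span_centralUniversalRep (hN : N ≤ Subgroup.center G) (χ : N →* Circle) :
    Dense (Submodule.span ℂ (Set.range fun g =>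
      (centralUniversalRep hN χ g : TwistedGroupCStar (characterCocycle hN χ))) :
      Set (TwistedGroupCStar (characterCocycle hN χ))) := by
  refine (dense_span_twistedUnitary (characterCocycle hN χ)).mono ?_
  refine Submodule.span_le.mpr ?_
  rintro _ ⟨x, rfl⟩
  obtain ⟨g, rfl⟩ := QuotientGroup.mk_surjective x
  have h : (twistedUnitary (characterCocycle hN χ) (g : G ⧸ N) : TwistedGroupCStar (characterCocycle hN χ)) =
      (χ (sectionDefect N g) : ℂ)⁻¹ •
        (centralUniversalRep hN χ g : TwistedGroupCStar (characterCocycle hN χ)) := by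
    rw [centralUniversalRep_apply, inv_smul_smul₀ (Circle.coe_ne_zero _)]
  change (twistedUnitary (characterCocycle hN χ) (g : G ⧸ N) : TwistedGroupCStar (characterCocycle hN χ)) ∈ _
  rw [h]
  exact Submodule.smul_mem _ _ (Submodule.subset_span ⟨g, rfl⟩)

/-- A unitary representation of `G` restricting to the character `χ` on `N`, as a twisted
representation of `G ⧸ N`. -/
noncomputable def twistedRepOfRep (hN : N ≤ Subgroup.center G) (χ : N →* Circle)
    {K : Type u} [NormedAddCommGroup K] [InnerProductSpace ℂ K] [CompleteSpace K] [Nontrivial K]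
    (π : G →* unitary (K →L[ℂ] K)) (hχ : ∀ n : N, (π n : K →L[ℂ] K) = (χ n : ℂ) • 1) :
    TwistedRep (characterCocycle hN χ) where
  space := K
  V x := π (normalizedSection N x)
  map_mul' x y := by
    rw [← Submonoid.coe_mul, ← map_mul, normalizedSection_mul, map_mul, Submonoid.coe_mul, hχ,
      smul_one_mul]
    rfl

end CentralCharacter

/-! ### Transport along unitary equivalences. -/

section Transport

variable {G : Type*} [Group G] {H : Type*} [NormedAddCommGroup H] [InnerProductSpace ℂ H]
  [CompleteSpace H] {K : Type*} [NormedAddCommGroup K] [InnerProductSpace ℂ K] [CompleteSpace K]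

/-- Transport of a unitary representation along a unitary equivalence. -/
noncomputable def conjRep (e : H ≃ₗᵢ[ℂ] K) (π : G →* unitary (H →L[ℂ] H)) :
    G →* unitary (K →L[ℂ] K) where
  toFun g := ⟨e.conjStarAlgEquiv (π g : H →L[ℂ] H), Unitary.map_mem e.conjStarAlgEquiv (π g).2⟩
  map_one' := Subtype.ext (by simp)
  map_mul' g h := Subtype.ext (by simp)

lemma conjRep_apply (e : H ≃ₗᵢ[ℂ] K) (π : G →* unitary (H →L[ℂ] H)) (g : G) :
    (conjRep e π g : K →L[ℂ] K) = e.conjStarAlgEquiv (π g : H →L[ℂ] H) := rfl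

end Transport

/-! ### The main theorem. -/

theorem theorem4p6 {G : Type*} [Group G] [Group.FG G] [Group.IsNilpotent G]
    {H : Type*} [NormedAddCommGroup H] [InnerProductSpace ℂ H] [CompleteSpace H]
    (π : G →* unitary (H →L[ℂ] H)) (hfaithful : Function.Injective π)
    (hirr : IsIrreducibleRep π) :
    ∃ (N : Subgroup G) (_ : N.Normal) (σ : TwoCocycle (G ⧸ N))
      (p : TwistedGroupCStar σ) (hp : IsStarProjection p)
      (hc : p ∈ Set.center (TwistedGroupCStar σ)),
      N ≤ Subgroup.center G ∧ N.IsFiniteRelIndex (Subgroup.center G) ∧ IsMulTorsionFree N ∧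
      Nonempty (repCStarAlgebra π ≃⋆ₐ[ℂ] centralCutdown p hp hc) ∧
      TwoCocycle.Homotopic σ (TwoCocycle.trivial (G ⧸ N)) := by
  have := hirr.1
  have hscalar : ∀ z ∈ Subgroup.center G, ∃ c : ℂ, (π z : H →L[ℂ] H) = c • 1 := fun z hz =>
    hirr.exists_eq_smul_one_of_mem_center hz
  obtain ⟨N, hN, hfin, htf⟩ := exists_torsionFree_finiteRelIndex_center G
  have hnormal : N.Normal :=
    ⟨fun n hn g => by rwa [Subgroup.mem_center_iff.mp (hN hn) g, mul_inv_cancel_right]⟩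
  have hfg : Group.FG N := (Group.fg_iff_subgroup_fg _).mpr (Subgroup.fg_of_nilpotent _)
  obtain ⟨χ, hχ⟩ := exists_centralCharacter π fun n hn => hscalar n (hN hn)
  -- `TwistedRep` only admits spaces in the universe of `G`. Countability of `G` makes `H`
  -- separable, so `H` is isometric to an `ℓ²` space in that universe and `π` can be transported
  -- there.
  have hcount := Group.countable_of_fg G
  have hsep := hirr.separableSpace
  obtain ⟨ι, ⟨e⟩⟩ := exists_linearIsometryEquiv_of_separableSpace H
  have : Nontrivial (lp (fun _ : ι => ℂ) 2) := e.injective.nontrivial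
  let ρ := twistedRepOfRep hN χ (conjRep e π) fun n => by
    rw [conjRep_apply, hχ, map_smul, map_one]
  let E : TwistedGroupCStar (characterCocycle hN χ) →⋆ₐ[ℂ] (H →L[ℂ] H) :=
    e.conjStarAlgEquiv.symm.toStarAlgHom.comp ρ.lift
  have hE : ∀ g, (π g : H →L[ℂ] H) = E (centralUniversalRep hN χ g) := by
    intro g
    change _ = e.conjStarAlgEquiv.symm (ρ.lift _)
    rw [centralUniversalRep_apply, map_smul, TwistedRep.lift_twistedUnitary]
    change _ = e.conjStarAlgEquiv.symm ((χ (sectionDefect N g) : ℂ) •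
      e.conjStarAlgEquiv (π (normalizedSection N (g : G ⧸ N)) : H →L[ℂ] H))
    rw [map_smul, StarAlgEquiv.symm_apply_apply, ← smul_one_mul, ← hχ, ← Submonoid.coe_mul,
      ← map_mul, sectionDefect_mul_normalizedSection]
  obtain ⟨p, -, hp, hcomm, hEp, hle⟩ := exists_projection_norm_mul_le E hE hfaithful hscalar hN hfin
    fun n hn => ⟨_, centralUniversalRep_of_mem hN χ hn⟩
  have hdense := dense_span_centralUniversalRep hN χ
  have hc : p ∈ Set.center (TwistedGroupCStar (characterCocycle hN χ)) := by
    refine Semigroup.mem_center_iff.mpr fun a => ?_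
    refine hdense.induction (P := fun a => a * p = p * a) (fun a ha => ?_)
      (isClosed_eq (continuous_mul_const p) (continuous_const_mul p)) a
    induction ha using Submodule.span_induction with
    | mem _ hx => obtain ⟨g, rfl⟩ := hx; exact (hcomm g).eq.symm
    | zero => simp
    | add x y _ _ hx hy => rw [add_mul, mul_add, hx, hy]
    | smul c x _ hx => rw [smul_mul_assoc, mul_smul_comm, hx]
  have hcont : Continuous E :=
    AddMonoidHomClass.continuous_of_bound E 1 fun a => by
      rw [one_mul]; exact NonUnitalStarAlgHom.norm_apply_le E a
  -- The estimate extends from the dense span by continuity of both sides.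
  have hle' : ∀ a, ‖p * a‖ ≤ ‖E a‖ := fun a =>
    hdense.induction (P := fun a => ‖p * a‖ ≤ ‖E a‖) (fun a ha => hle a ha)
      (isClosed_le (continuous_const_mul p).norm hcont.norm) a
  exact ⟨N, hnormal, characterCocycle hN χ, p, hp, hc, hN, hfin, htf,
    nonempty_repCStarAlgebra_equiv_centralCutdown hp hc E hEp (fun g => (hE g).symm) hdense hle',
    characterCocycle_homotopic_trivial hN χ⟩
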